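/- Let $N\ge1$, let $0<m<1$ and consider the stationary problem $$-i\Delta u+a|u|^{-(1-m)}u+bu=F\ \text{ in }\Omega,\qquad u=0\ \text{ on }\partial\Omega,\qquad(1)$$ where $\Omega\subseteq\mathbb{R}^N$ is open and nonempty, $u,F$ are complex valued, $a,b\in\mathbb{C}$, and $|z|^{-(1-m)}z=0$ at $z=0$. A *local weak solution* of the equation (with $F\in L^1_{\rm loc}(\Omega)$) is a function $u\in H^1_{\rm loc}(\Omega)$ that satisfies it in $\mathscr D'(\Omega)$; a *global weak solution* of (1) is a local weak solution with $u\in H^1_0(\Omega)\cap L^{m+1}(\Omega)$, where $H^1_0(\Omega)$ is the closure of $\mathscr D(\Omega)$ in $H^1(\Omega)$. Let $\mathbb A=\mathbb C\setminus\{z:\operatorname{Re}z=0,\ \operatorname{Im}z\le0\}$ and $\mathbb B=\mathbb A\cup\{0\}$. Assume that $(a,b)\in\mathbb A\times\mathbb B$ and that either $\operatorname{Re}a\operatorname{Re}b\ge0$, or $\operatorname{Re}a\operatorname{Re}b<0$ and $\operatorname{Im}b>\frac{\operatorname{Re}b}{\operatorname{Re}a}\operatorname{Im}a$. For an arbitrary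 $\delta>0$ put $A(\delta)=\frac{|\operatorname{Re}a|+|\operatorname{Im}a|+\delta}{|\operatorname{Re}a|}$ if $\operatorname{Re} a\ne0$, $B=\frac{|\operatorname{Re}b|+|\operatorname{Im}b|}{|\operatorname{Re}b|}$ if $\operatorname{Re} b\neq0$, $$L=\begin{cases}\delta,&\operatorname{Im}a<0,\ \operatorname{Re}a\operatorname{Re}b\ge0,\\|\operatorname{Re}a|,&\operatorname{Im}a=0,\ \operatorname{Im}b\ge0,\ \operatorname{Re}a\operatorname{Re}b\ge0,\\\operatorname{Im}a,&\operatorname{Im}a>0,\ \operatorname{Im}b\ge0,\\\operatorname{Im}a-\frac{\operatorname{Re}a}{\operatorname{Re}b}\operatorname{Im}b,&\text{otherwise},\end{cases}$$ $$M=\begin{cases}\max\{A(\delta),B\},&\operatorname{Im}a<0,\ \operatorname{Im}b<0,\ \operatorname{Re}a\operatorname{Re}b\ge0,\\A(\delta),&\operatorname{Im}a<0,\ \operatorname{Im}b\ge0,\ \operatorname{Re}a\operatorname{Re}b\ge0,\\2,&\operatorname{Im}a\ge0,\ \operatorname{Im}b\ge0\text{ and }(\operatorname{Im}a>0\text{ or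 }\operatorname{Re}a\operatorname{Re}b\ge0),\\B,&(\operatorname{Im}a\ge0\text{ and }\operatorname{Im}b<0)\text{ or }\operatorname{Re}a\operatorname{Re}b<0,\end{cases}$$ (where the last two cases for $M$ overlap, either value may be taken), and $$M_0=M\Big(\frac{2M}{L}\Big)^{1/m}\max\Big\{1,\frac2L\Big\},\qquad \sigma=\frac{2(1-m)}{(N+2)-m(N-2)},\qquad \widetilde M_0=M_0(1+M_0^{\sigma}).$$ **Theorem 4.4.** There is a constant $C=C(N,m)>0$, depending only on $N$ and $m$ and continuous in $m\in(0,1)$, such that for all $\Omega,a,b,\delta$ as above, every $F\in L^{\frac{m+1}{m}}(\Omega)$ that is not almost everywhere zero, and every global weak solution $u$ of (1), $$\|\nabla u\|_{L^2(\Omega)}^2+\|u\|_{L^{m+1}(\Omega)}^{m+1}<M_0\|F\|_{L^{\frac{m+1}{m}}(\Omega)}^{\frac{m+1}{m}},$$ $$\|u\|_{H^1_0(\Omega)}^2+\|u\|_{L^{m+1}(\Omega)}^{m+1}<C\widetilde M_0\Big(1+\|F\|_{L^{\frac{m+1}{m}}(\Omega)}^{\frac{\sigma(m+1)}{m}}\Big)\|F\|_{L^{\frac{m+1}{m}}(\Omega)}^{\frac{m+1}{m}},$$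 where $\|u\|_{H^1_0(\Omega)}^2=\|u\|_{L^2(\Omega)}^2+\|\nabla u\|_{L^2(\Omega)}^2$. If $F=0$ almost everywhere, both estimates hold with $\le$ in place of $<$ (so that $u=0$). -/

import Mathlib

open MeasureTheory Filter Topology TopologicalSpace
open scoped ENNReal Distributions Laplacian

noncomputable section

namespace StationaryNLS

/-- The Euclidean space `ℝ^N`. -/
abbrev Eucl (N : ℕ) : Type := EuclideanSpace ℝ (Fin N)

/-- The space `ℂ^N` of values of gradients, with its Hermitian norm. -/
abbrev CVec (N : ℕ) : Type := EuclideanSpace ℂ (Fin N)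

/-- The `j`-th partial derivative of a (differentiable) function on `ℝ^N`. -/
def partialDeriv {N : ℕ} (j : Fin N) (φ : Eucl N → ℂ) (x : Eucl N) : ℂ :=
  fderiv ℝ φ x (EuclideanSpace.single j (1 : ℝ))

/-- The gradient of a (differentiable) function on `ℝ^N`. -/
def classicalGrad {N : ℕ} (φ : Eucl N → ℂ) (x : Eucl N) : CVec N :=
  WithLp.toLp 2 (fun j => partialDeriv j φ x)

/-- Lebesgue measure on `Ω`. -/
abbrev leb {N : ℕ} (Ω : Opens (Eucl N)) : Measure (Eucl N) :=
  (volume : Measure (Eucl N)).restrict (Ω : Set (Eucl N))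

/-- The `L^p(Ω)` norm, `0 < p < ∞`, as a real number (meaningful for elements of `L^p(Ω)`). -/
def lpNormOn {N : ℕ} {V : Type*} [NormedAddCommGroup V] (Ω : Opens (Eucl N)) (p : ℝ)
    (f : Eucl N → V) : ℝ :=
  (eLpNorm f (ENNReal.ofReal p) (leb Ω)).toReal

/-- `Du` is the weak (distributional) gradient of `u` in `Ω`; both are locally integrable. -/
structure HasWeakGradient {N : ℕ} (Ω : Opens (Eucl N)) (u : Eucl N → ℂ)
    (Du : Eucl N → CVec N) : Prop where
  locallyIntegrable : LocallyIntegrableOn u (Ω : Set (Eucl N)) volume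
  locallyIntegrable_grad : LocallyIntegrableOn Du (Ω : Set (Eucl N)) volume
  integral_eq : ∀ (φ : 𝓓(Ω, ℂ)) (j : Fin N),
    ∫ x in (Ω : Set (Eucl N)), u x * partialDeriv j φ x
      = -∫ x in (Ω : Set (Eucl N)), Du x j * φ x

/-- `u ∈ H¹_loc(Ω)`: `u` and its weak gradient are square integrable on compact subsets of `Ω`. -/
def MemH1loc {N : ℕ} (Ω : Opens (Eucl N)) (u : Eucl N → ℂ) : Prop :=
  ∃ Du : Eucl N → CVec N, HasWeakGradient Ω u Du ∧
    ∀ K : Set (Eucl N), IsCompact K → K ⊆ (Ω : Set (Eucl N)) →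
      MemLp u 2 (volume.restrict K) ∧ MemLp Du 2 (volume.restrict K)

/-- `u ∈ H¹₀(Ω)`: `u` belongs to `H¹(Ω)` and is the limit, in the `H¹` norm, of a sequence of test
functions on `Ω`. -/
def MemH10 {N : ℕ} (Ω : Opens (Eucl N)) (u : Eucl N → ℂ) : Prop :=
  ∃ Du : Eucl N → CVec N, HasWeakGradient Ω u Du ∧ MemLp u 2 (leb Ω) ∧ MemLp Du 2 (leb Ω) ∧
    ∃ φ : ℕ → 𝓓(Ω, ℂ),
      Tendsto (fun n => eLpNorm (fun x => u x - φ n x) 2 (leb Ω)) atTop (𝓝 0) ∧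
      Tendsto (fun n => eLpNorm (fun x => Du x - classicalGrad (φ n) x) 2 (leb Ω)) atTop (𝓝 0)

/-- The singular nonlinearity `|z|^{-(1-m)} z`, equal to `0` at `z = 0`. -/
def singularPower (m : ℝ) (z : ℂ) : ℂ :=
  if z = 0 then 0 else ((‖z‖ ^ (-(1 - m)) : ℝ) : ℂ) * z

/-- `u` is a local weak solution of `-iΔu + a|u|^{-(1-m)}u + bu = F` in `Ω`: `F ∈ L¹_loc(Ω)`,
`u ∈ H¹_loc(Ω)`, and the equation holds in the sense of distributions, for the real duality
product `⟨T, φ⟩ = Re ∫ T φ̄`. -/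
structure IsLocalWeakSolution {N : ℕ} (Ω : Opens (Eucl N)) (m : ℝ) (a b : ℂ)
    (F u : Eucl N → ℂ) : Prop where
  source : LocallyIntegrableOn F (Ω : Set (Eucl N)) volume
  memH1loc : MemH1loc Ω u
  equation : ∀ φ : 𝓓(Ω, ℂ),
    (∫ x in (Ω : Set (Eucl N)),
        (-Complex.I * u x * starRingEnd ℂ (Δ (φ : Eucl N → ℂ) x)
          + (a * singularPower m (u x) + b * u x) * starRingEnd ℂ (φ x))).re
      = (∫ x in (Ω : Set (Eucl N)), F x * starRingEnd ℂ (φ x)).re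

/-- `u` is a global weak solution of `-iΔu + a|u|^{-(1-m)}u + bu = F` in `Ω`, `u = 0` on `∂Ω`:
a local weak solution that belongs to `H¹₀(Ω) ∩ L^{m+1}(Ω)`. -/
structure IsGlobalWeakSolution {N : ℕ} (Ω : Opens (Eucl N)) (m : ℝ) (a b : ℂ)
    (F u : Eucl N → ℂ) : Prop where
  isLocal : IsLocalWeakSolution Ω m a b F u
  memH10 : MemH10 Ω u
  memLp : MemLp u (ENNReal.ofReal (m + 1)) (leb Ω)

/-- The set `𝔸`: the complex plane without the half-line `{Re z = 0, Im z ≤ 0}`. -/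
def setA : Set ℂ := {z | ¬ (z.re = 0 ∧ z.im ≤ 0)}

/-- The set `𝔹 = 𝔸 ∪ {0}`. -/
def setB : Set ℂ := setA ∪ {0}

/-- The structural assumption on the coefficients `(a, b)`. -/
def Admissible (a b : ℂ) : Prop :=
  a ∈ setA ∧ b ∈ setB ∧
    (0 ≤ a.re * b.re ∨ (a.re * b.re < 0 ∧ b.re / a.re * a.im < b.im))

/-- The constant `A(δ)` (used only when `Re a ≠ 0`). -/
def constA (a : ℂ) (δ : ℝ) : ℝ := (|a.re| + |a.im| + δ) / |a.re|

/-- The constant `B` (used only when `Re b ≠ 0`). -/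
def constB (b : ℂ) : ℝ := (|b.re| + |b.im|) / |b.re|

open Classical in
/-- The constant `L`; the first three cases are mutually exclusive. -/
def constL (a b : ℂ) (δ : ℝ) : ℝ :=
  if a.im < 0 ∧ 0 ≤ a.re * b.re then δ
  else if a.im = 0 ∧ 0 ≤ b.im ∧ 0 ≤ a.re * b.re then |a.re|
  else if 0 < a.im ∧ 0 ≤ b.im then a.im
  else a.im - a.re / b.re * b.im

/-- `M` is a value given by the four-case definition of the constant `M`. The last two cases
overlap when `Im a > 0`, `Im b ≥ 0` and `Re a Re b < 0`; then both `2` and `B` are values. -/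
def IsConstM (a b : ℂ) (δ M : ℝ) : Prop :=
  (a.im < 0 ∧ b.im < 0 ∧ 0 ≤ a.re * b.re ∧ M = max (constA a δ) (constB b)) ∨
  (a.im < 0 ∧ 0 ≤ b.im ∧ 0 ≤ a.re * b.re ∧ M = constA a δ) ∨
  (0 ≤ a.im ∧ 0 ≤ b.im ∧ (0 < a.im ∨ 0 ≤ a.re * b.re) ∧ M = 2) ∨
  (((0 ≤ a.im ∧ b.im < 0) ∨ a.re * b.re < 0) ∧ M = constB b)

/-- The constant `M₀ = M (2M/L)^{1/m} max {1, 2/L}`. -/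
def constM0 (m L M : ℝ) : ℝ := M * (2 * M / L) ^ (1 / m) * max 1 (2 / L)

/-- The Gagliardo–Nirenberg exponent `2(1-m) / ((N+2) - m(N-2))`. -/
def expGN (N : ℕ) (m : ℝ) : ℝ := 2 * (1 - m) / (((N : ℝ) + 2) - m * ((N : ℝ) - 2))

/-- The constant `M̃₀ = M₀ (1 + M₀^σ)`, where `σ` is the Gagliardo–Nirenberg exponent. -/
def constM0tilde (N : ℕ) (m L M : ℝ) : ℝ :=
  constM0 m L M * (1 + constM0 m L M ^ expGN N m)

/-- The power `‖F‖^{(m+1)/m}` of the norm of `F` in `L^{(m+1)/m}(Ω)`. -/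
def sourceSize {N : ℕ} (Ω : Opens (Eucl N)) (m : ℝ) (F : Eucl N → ℂ) : ℝ :=
  lpNormOn Ω ((m + 1) / m) F ^ ((m + 1) / m)

/-- The energy `‖∇u‖²_{L²(Ω)} + ‖u‖^{m+1}_{L^{m+1}(Ω)}`, with `Du = ∇u`. -/
def energy {N : ℕ} (Ω : Opens (Eucl N)) (m : ℝ) (u : Eucl N → ℂ) (Du : Eucl N → CVec N) : ℝ :=
  lpNormOn Ω 2 Du ^ 2 + lpNormOn Ω (m + 1) u ^ (m + 1)

/-- The square `‖u‖²_{L²(Ω)} + ‖∇u‖²_{L²(Ω)}` of the `H¹₀(Ω)` norm of `u`, with `Du = ∇u`. -/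
def h1NormSq {N : ℕ} (Ω : Opens (Eucl N)) (u : Eucl N → ℂ) (Du : Eucl N → CVec N) : ℝ :=
  lpNormOn Ω 2 u ^ 2 + lpNormOn Ω 2 Du ^ 2

end StationaryNLS

end

open StationaryNLS

namespace StationaryNLS

/-! The solution is used as its own test function. With `X = ‖∇u‖₂²`, `Y = ‖u‖_{m+1}^{m+1}`, `Z =
‖u‖₂²` this gives `iX + aY + bZ = ∫ F ū` (`IsLocalWeakSolution.energy_identity`). The admissibility
of `(a, b)` is what allows its real and imaginary parts to be combined, in each sign configuration,
into `X + L Y ≤ M ‖F‖ ‖u‖_{m+1}` (`add_constL_mul_le`). Since `m > 0`, the factor `‖u‖_{m+1}` is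
absorbed by `L Y` (`add_rpow_le_of_add_mul_rpow_le`), with a constant strictly below `M₀`; this gap
yields the strict inequality when `F ≠ 0`.

Testing with `u` requires test functions converging to `u` in `H¹` and in `L^{m+1}` simultaneously,
whereas membership in `H¹₀` only provides the former. Cutoffs and a diagonal choice repair this
(`exists_test_tendsto`).

The second estimate adds `‖u‖₂²`, controlled by a Gagliardo–Nirenberg inequality `Z ≤ c (X +
Y)^{1+σ}`. It is proved for every dimension at once by averaging translates over a ball of radius
`r` (`lintegral_test_le`), passing to the limit (`lpNormOn_two_sq_le`) and choosing `r`
(`le_rpow_of_forall_scale`). -/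

/-! ### Algebra of the coefficients: combining the two energy identities. -/

theorem Admissible.re_ne_zero_of_im_nonpos {a b : ℂ} (h : Admissible a b) (ha : a.im ≤ 0) :
    a.re ≠ 0 := fun h0 => h.1 ⟨h0, ha⟩

theorem Admissible.re_ne_zero_of_im_neg {a b : ℂ} (h : Admissible a b) (hb : b.im < 0) :
    b.re ≠ 0 := by
  intro h0
  rcases h.2.1 with h1 | h1
  · exact h1 ⟨h0, hb.le⟩
  · rw [Set.mem_singleton_iff.1 h1] at hb
    simp at hb

/-- When `Re a Re b ≥ 0` no cancellation occurs in the real part of the energy identity, so it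
controls `Y` and `Z` separately. -/
theorem abs_add_abs_of_mul_nonneg {x y : ℝ} (h : 0 ≤ x * y) {Y Z : ℝ} (hY : 0 ≤ Y)
    (hZ : 0 ≤ Z) : |x| * Y + |y| * Z = |x * Y + y * Z| := by
  have h1 : 0 ≤ (x * Y) * (y * Z) := by
    have := mul_nonneg h (mul_nonneg hY hZ)
    nlinarith
  rw [(abs_add_eq_add_abs_iff _ _).2 (by
    rcases mul_nonneg_iff.1 h1 with h | h
    · exact Or.inl h
    · exact Or.inr h), abs_mul, abs_mul, abs_of_nonneg hY, abs_of_nonneg hZ]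

theorem one_le_constA {a : ℂ} {δ : ℝ} (hδ : 0 < δ) (h : a.re ≠ 0) : 1 ≤ constA a δ := by
  have h1 : 0 < |a.re| := abs_pos.2 h
  rw [constA, le_div_iff₀ h1]
  linarith [abs_nonneg a.im]

theorem one_le_constB {b : ℂ} (h : b.re ≠ 0) : 1 ≤ constB b := by
  have h1 : 0 < |b.re| := abs_pos.2 h
  rw [constB, le_div_iff₀ h1]
  linarith [abs_nonneg b.im]

theorem one_le_of_isConstM {a b : ℂ} {δ M : ℝ} (hab : Admissible a b) (hδ : 0 < δ)
    (hM : IsConstM a b δ M) : 1 ≤ M := by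
  rcases hM with ⟨h1, h2, h3, rfl⟩ | ⟨h1, h2, h3, rfl⟩ | ⟨h1, h2, h3, rfl⟩ | ⟨h, rfl⟩
  · exact le_max_of_le_left (one_le_constA hδ (hab.re_ne_zero_of_im_nonpos h1.le))
  · exact one_le_constA hδ (hab.re_ne_zero_of_im_nonpos h1.le)
  · norm_num
  · refine one_le_constB ?_
    rcases h with h | h
    · exact hab.re_ne_zero_of_im_neg h.2
    · rintro h0
      simp [h0] at h

/-- The last branch in the definition of `L` is positive. -/
theorem Admissible.sub_pos {a b : ℂ} (hab : Admissible a b)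
    (h : (0 ≤ a.im ∧ b.im < 0) ∨ a.re * b.re < 0) : 0 < a.im - a.re / b.re * b.im := by
  by_cases hs : a.re * b.re < 0
  · have hb : b.re / a.re * a.im < b.im := by
      rcases hab.2.2 with h1 | h1
      · linarith
      · exact h1.2
    have ha0 : a.re ≠ 0 := by rintro h0; simp [h0] at hs
    have hb0 : b.re ≠ 0 := by rintro h0; simp [h0] at hs
    have hneg : a.re / b.re < 0 := by
      have : a.re / b.re = a.re * b.re / b.re ^ 2 := by field_simp
      rw [this]
      exact div_neg_of_neg_of_pos hs (by positivity)
    -- Multiplying the structural inequality by the negative number `Re a / Re b` turns it into the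
    -- positivity of `L`.
    have := mul_lt_mul_of_neg_left hb hneg
    have e : a.re / b.re * (b.re / a.re * a.im) = a.im := by field_simp
    linarith
  · rcases h with ⟨h1, h2⟩ | h
    · have hb0 := hab.re_ne_zero_of_im_neg h2
      have hq : a.re / b.re = a.re * b.re / b.re ^ 2 := by field_simp
      have hq0 : 0 ≤ a.re / b.re := by
        rw [hq]; exact div_nonneg (not_lt.1 hs) (by positivity)
      -- Both terms of `Im a - (Re a / Re b) Im b` are nonnegative here. If `Im a = 0`, then `a ∈ 𝔸`
      -- forces `Re a ≠ 0` and the second term is strictly positive.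
      rcases h1.eq_or_lt with h3 | h3
      · have ha0 := hab.re_ne_zero_of_im_nonpos h3.symm.le
        have : 0 < a.re / b.re := lt_of_le_of_ne hq0 (Ne.symm (div_ne_zero ha0 hb0))
        nlinarith
      · nlinarith
    · exact absurd h hs

theorem constL_pos {a b : ℂ} {δ : ℝ} (hab : Admissible a b) (hδ : 0 < δ) :
    0 < constL a b δ := by
  unfold constL
  split_ifs with h1 h2 h3
  · exact hδ
  · exact abs_pos.2 (hab.re_ne_zero_of_im_nonpos h2.1.le)
  · exact h3.1
  · refine hab.sub_pos ?_
    by_contra! h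
    rcases lt_trichotomy a.im 0 with h4 | h4 | h4
    · exact h1 ⟨h4, h.2⟩
    · exact h2 ⟨h4, h.1 h4.ge, h.2⟩
    · exact h3 ⟨h4, h.1 h4.le⟩

/-- The two energy identities bound `X + L Y` by `M` times the size of the source term. -/
theorem add_constL_mul_le {a b : ℂ} {δ M : ℝ} (hab : Admissible a b) (hδ : 0 < δ)
    (hM : IsConstM a b δ M) {X Y Z R J I : ℝ} (hY : 0 ≤ Y) (hZ : 0 ≤ Z)
    (hre : a.re * Y + b.re * Z = R) (him : X + a.im * Y + b.im * Z = J)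
    (hR : |R| ≤ I) (hJ : |J| ≤ I) : X + constL a b δ * Y ≤ M * I := by
  have hI : 0 ≤ I := (abs_nonneg _).trans hR
  have hM1 := one_le_of_isConstM hab hδ hM
  have hJ' : J ≤ I := (le_abs_self J).trans hJ
  have hMI : I ≤ M * I := le_mul_of_one_le_left hI hM1
  have hsame (h : 0 ≤ a.re * b.re) : |a.re| * Y + |b.re| * Z ≤ I := by
    rw [abs_add_abs_of_mul_nonneg h hY hZ, hre]; exact hR
  unfold constL
  split_ifs with h1 h2 h3
  · have ha0 := abs_pos.2 (hab.re_ne_zero_of_im_nonpos h1.1.le)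
    have hs := hsame h1.2
    have haim : |a.im| = -a.im := abs_of_neg h1.1
    rcases lt_or_ge b.im 0 with hb | hb
    · have hMeq : M = max (constA a δ) (constB b) := by
        rcases hM with h | h | h | h
        · exact h.2.2.2
        · linarith [h.2.1]
        · linarith [h.1, h1.1]
        · rcases h.1 with h | h
          · linarith [h1.1, h.1]
          · linarith [h1.2]
      have hb0 := abs_pos.2 (hab.re_ne_zero_of_im_neg hb)
      have hbim : |b.im| = -b.im := abs_of_neg hb
      -- `X + δY = J + (|Im a| + δ) Y + |Im b| Z`, and `M - 1` times the bound on `|Re a| Y + |Re b|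
      -- Z` pays for the last two terms.
      have e1 : (|a.im| + δ) ≤ (M - 1) * |a.re| := by
        have : constA a δ ≤ M := hMeq ▸ le_max_left _ _
        rw [constA, div_le_iff₀ ha0] at this
        linarith
      have e2 : |b.im| ≤ (M - 1) * |b.re| := by
        have : constB b ≤ M := hMeq ▸ le_max_right _ _
        rw [constB, div_le_iff₀ hb0] at this
        linarith
      have e3 := mul_le_mul_of_nonneg_right e1 hY
      have e4 := mul_le_mul_of_nonneg_right e2 hZ
      have e5 := mul_le_mul_of_nonneg_left hs (sub_nonneg.2 hM1)
      rw [haim] at e3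
      rw [hbim] at e4
      nlinarith
    · have hMeq : M = constA a δ := by
        rcases hM with h | h | h | h
        · linarith [h.2.1]
        · exact h.2.2.2
        · linarith [h.1, h1.1]
        · rcases h.1 with h | h
          · linarith [h1.1, h.1]
          · linarith [h1.2]
      have e1 : (|a.im| + δ) = (M - 1) * |a.re| := by
        rw [hMeq, constA]; field_simp; ring
      have e5 := mul_le_mul_of_nonneg_left hs (sub_nonneg.2 hM1)
      have e6 := mul_nonneg (sub_nonneg.2 hM1) (mul_nonneg (abs_nonneg b.re) hZ)
      have e7 := mul_nonneg hb hZ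
      have e8 : (|a.im| + δ) * Y = (M - 1) * |a.re| * Y := by rw [e1]
      rw [haim] at e8
      nlinarith
  · have hMeq : M = 2 := by
      rcases hM with h | h | h | h
      · linarith [h.1, h2.1]
      · linarith [h.1, h2.1]
      · exact h.2.2.2
      · rcases h.1 with h | h
        · linarith [h.2, h2.2.1]
        · linarith [h2.2.2]
    -- The imaginary part bounds `X` by `I`, the real part bounds `|Re a| Y` by `I`; hence `M = 2`.
    have hs := hsame h2.2.2
    have e6 := mul_nonneg (abs_nonneg b.re) hZ
    have e7 := mul_nonneg h2.2.1 hZ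
    rw [h2.1] at him
    rw [hMeq]
    linarith
  -- The imaginary part alone suffices, and only `1 ≤ M` is needed; the two admissible values of `M`
  -- need not be distinguished.
  · have e7 := mul_nonneg h3.2 hZ
    linarith
  · have hcase : (0 ≤ a.im ∧ b.im < 0) ∨ a.re * b.re < 0 := by
      by_contra! h
      rcases lt_trichotomy a.im 0 with h4 | h4 | h4
      · exact h1 ⟨h4, h.2⟩
      · exact h2 ⟨h4, h.1 h4.ge, h.2⟩
      · exact h3 ⟨h4, h.1 h4.le⟩
    have hb0 : b.re ≠ 0 := by
      rcases hcase with h | h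
      · exact hab.re_ne_zero_of_im_neg h.2
      · rintro h0
        simp [h0] at h
    have hMeq : M = constB b := by
      rcases hM with h | h | h | h
      · exact absurd ⟨h.1, h.2.2.1⟩ h1
      · exact absurd ⟨h.1, h.2.2.1⟩ h1
      · exfalso
        rcases hcase with h' | h'
        · linarith [h.2.1, h'.2]
        · rcases h.2.2.1 with h4 | h4
          · exact h3 ⟨h4, h.2.1⟩
          · linarith
      · exact h.2
    have hb1 := abs_pos.2 hb0
    -- `Z` is eliminated by subtracting `Im b / Re b` times the real identity from the imaginary
    -- one.
    have e : X + (a.im - a.re / b.re * b.im) * Y = J - b.im / b.re * R := by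
      rw [← hre, ← him]; field_simp; ring
    have e2 : |b.im / b.re * R| ≤ |b.im| / |b.re| * I := by
      rw [abs_mul, abs_div]
      exact mul_le_mul_of_nonneg_left hR (by positivity)
    have e3 : constB b * I = I + |b.im| / |b.re| * I := by
      unfold constB; field_simp
    rw [e, hMeq, e3]
    linarith [neg_abs_le (b.im / b.re * R)]

/-! ### Absorption of the source term and the constant `M₀`. -/

/-- Absorbing the source term: `X + L y^{m+1} ≤ M f y` bounds `X + y^{m+1}` by
`M (M/L)^{1/m} max {1, 1/L}` times `f^{(m+1)/m}`. -/
theorem add_rpow_le_of_add_mul_rpow_le {m L M X f y : ℝ} (hm : 0 < m) (hL : 0 < L) (hM : 0 < M)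
    (hX : 0 ≤ X) (hf : 0 ≤ f) (hy : 0 ≤ y) (h : X + L * y ^ (m + 1) ≤ M * (f * y)) :
    X + y ^ (m + 1) ≤ M * (M / L) ^ (1 / m) * max 1 (1 / L) * f ^ ((m + 1) / m) := by
  have hy1 : 0 ≤ y ^ (m + 1) := Real.rpow_nonneg hy _
  -- Dropping `X ≥ 0` and dividing by `y` gives `L y^m ≤ M f`.
  have hyb : y ≤ (M * f / L) ^ (1 / m) := by
    rcases hy.eq_or_lt with h0 | h0
    · rw [← h0]; positivity
    have h1 : L * (y ^ m * y) ≤ M * f * y := by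
      rw [← Real.rpow_add_one h0.ne']; linarith
    have h2 : y ^ m ≤ M * f / L := by
      rw [le_div_iff₀ hL]
      refine le_of_mul_le_mul_right ?_ h0
      linarith
    calc y = (y ^ m) ^ (1 / m) := by
          rw [← Real.rpow_mul hy, mul_one_div_cancel hm.ne', Real.rpow_one]
      _ ≤ _ := Real.rpow_le_rpow (by positivity) h2 (by positivity)
  have hfs : f * f ^ (1 / m) = f ^ ((m + 1) / m) := by
    rcases hf.eq_or_lt with h0 | h0
    · rw [← h0, zero_mul, Real.zero_rpow (by positivity)]
    · rw [add_div, div_self hm.ne', Real.rpow_add h0, Real.rpow_one]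
  have hmain : X + L * y ^ (m + 1) ≤ M * (M / L) ^ (1 / m) * f ^ ((m + 1) / m) := by
    refine h.trans ?_
    calc M * (f * y) ≤ M * (f * (M * f / L) ^ (1 / m)) := by gcongr
      _ = M * (M / L) ^ (1 / m) * (f * f ^ (1 / m)) := by
          rw [mul_div_right_comm, Real.mul_rpow (by positivity) hf]; ring
      _ = _ := by rw [hfs]
  have hmx : 0 ≤ max 1 (1 / L) := le_max_of_le_left zero_le_one
  calc X + y ^ (m + 1) ≤ max 1 (1 / L) * (X + L * y ^ (m + 1)) := by
        rw [mul_add]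
        refine add_le_add (le_mul_of_one_le_left hX (le_max_left _ _)) ?_
        rw [← mul_assoc]
        refine le_mul_of_one_le_left hy1 ?_
        calc (1 : ℝ) = 1 / L * L := by field_simp
          _ ≤ _ := by gcongr; exact le_max_right _ _
    _ ≤ max 1 (1 / L) * (M * (M / L) ^ (1 / m) * f ^ ((m + 1) / m)) := by gcongr
    _ = _ := by ring

theorem constM0_pos {m L M : ℝ} (hL : 0 < L) (hM : 0 < M) : 0 < constM0 m L M := by
  unfold constM0
  have : 0 < max 1 (2 / L) := lt_max_of_lt_left one_pos
  positivity

/-- The factors `2` in `M₀` leave room above the constant actually obtained; this is the source of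
strictness in the theorem. -/
theorem lt_constM0 {m L M : ℝ} (hm : 0 < m) (hL : 0 < L) (hM : 0 < M) :
    M * (M / L) ^ (1 / m) * max 1 (1 / L) < constM0 m L M := by
  have h2 : (M / L) ^ (1 / m) < (2 * M / L) ^ (1 / m) := by
    refine Real.rpow_lt_rpow (by positivity) ?_ (by positivity)
    gcongr; linarith
  have h3 : max 1 (1 / L) ≤ max 1 (2 / L) := by gcongr; norm_num
  have h4 : 0 < max 1 (1 / L) := lt_max_of_lt_left one_pos
  unfold constM0
  calc M * (M / L) ^ (1 / m) * max 1 (1 / L)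
      < M * (2 * M / L) ^ (1 / m) * max 1 (1 / L) := by gcongr
    _ ≤ _ := by gcongr

theorem expGN_pos {N : ℕ} {m : ℝ} (hm : 0 < m) (hm1 : m < 1) : 0 < expGN N m := by
  unfold expGN
  refine div_pos (by linarith) ?_
  have : (0 : ℝ) ≤ N * (1 - m) := mul_nonneg (Nat.cast_nonneg _) (by linarith)
  nlinarith

/-! ### Test functions, weak gradients and integrability. -/

variable {N : ℕ} {Ω : Opens (Eucl N)}

/-- The `j`-th partial derivative of a test function, as a test function. -/
noncomputable def testPartial (j : Fin N) (φ : 𝓓(Ω, ℂ)) : 𝓓(Ω, ℂ) where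
  toFun := partialDeriv j φ
  contDiff' := (φ.contDiff.fderiv_right (m := ((⊤ : ℕ∞) : WithTop ℕ∞)) (by simp)).clm_apply
    contDiff_const
  hasCompactSupport' := φ.hasCompactSupport.fderiv_apply ℝ _
  tsupport_subset' := (tsupport_fderiv_apply_subset ℝ _).trans φ.tsupport_subset

/-- The complex conjugate of a test function, as a test function. -/
noncomputable def testConj (φ : 𝓓(Ω, ℂ)) : 𝓓(Ω, ℂ) where
  toFun x := starRingEnd ℂ (φ x)
  contDiff' := Complex.conjCLE.contDiff.comp φ.contDiff
  hasCompactSupport' := φ.hasCompactSupport.comp_left (map_zero _)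
  tsupport_subset' := (tsupport_comp_subset (map_zero _) _).trans φ.tsupport_subset

theorem testPartial_apply (j : Fin N) (φ : 𝓓(Ω, ℂ)) (x : Eucl N) :
    testPartial j φ x = partialDeriv j φ x := rfl

theorem differentiable_test (φ : 𝓓(Ω, ℂ)) : Differentiable ℝ φ :=
  φ.contDiff.differentiable (by simp)

theorem partialDeriv_conj (j : Fin N) {φ : Eucl N → ℂ} (hφ : Differentiable ℝ φ) (x : Eucl N) :
    partialDeriv j (fun y => starRingEnd ℂ (φ y)) x = starRingEnd ℂ (partialDeriv j φ x) := by
  have h : HasFDerivAt (fun y => starRingEnd ℂ (φ y))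
      ((Complex.conjCLE : ℂ →L[ℝ] ℂ).comp (fderiv ℝ φ x)) x :=
    (Complex.conjCLE : ℂ →L[ℝ] ℂ).hasFDerivAt.comp x (hφ x).hasFDerivAt
  rw [partialDeriv, h.fderiv]
  simp [partialDeriv]

theorem partialDeriv_const_smul (j : Fin N) (c : ℂ) {φ : Eucl N → ℂ} (hφ : Differentiable ℝ φ)
    (x : Eucl N) : partialDeriv j (c • φ) x = c * partialDeriv j φ x := by
  rw [partialDeriv, fderiv_const_smul (hφ x)]
  simp [partialDeriv]

theorem laplacian_test (φ : 𝓓(Ω, ℂ)) (x : Eucl N) :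
    Δ (φ : Eucl N → ℂ) x = ∑ j, partialDeriv j (partialDeriv j φ) x := by
  rw [InnerProductSpace.laplacian_eq_iteratedFDeriv_orthonormalBasis _
    (EuclideanSpace.basisFun (Fin N) ℝ)]
  refine Finset.sum_congr rfl fun j _ => ?_
  have hd : DifferentiableAt ℝ (fderiv ℝ φ) x :=
    (φ.contDiff.fderiv_right (m := 1) (by norm_cast)).differentiable (by simp) x
  rw [iteratedFDeriv_two_apply]
  unfold partialDeriv
  rw [fderiv_clm_apply hd (differentiableAt_const _)]
  simp

theorem memLp_test (φ : 𝓓(Ω, ℂ)) (p : ℝ≥0∞) (μ : Measure (Eucl N))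
    [IsFiniteMeasureOnCompacts μ] : MemLp φ p μ :=
  φ.continuous.memLp_of_hasCompactSupport φ.hasCompactSupport

theorem memLp_coord {μ : Measure (Eucl N)} {p : ℝ≥0∞} {f : Eucl N → CVec N} (hf : MemLp f p μ)
    (j : Fin N) : MemLp (fun x => f x j) p μ :=
  hf.of_le ((EuclideanSpace.proj (𝕜 := ℂ) j).continuous.comp_aestronglyMeasurable hf.1)
    (.of_forall fun x => PiLp.norm_apply_le (f x) j)

theorem memLp_conj {μ : Measure (Eucl N)} {p : ℝ≥0∞} {f : Eucl N → ℂ} (hf : MemLp f p μ) :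
    MemLp (fun x => starRingEnd ℂ (f x)) p μ :=
  hf.of_le (Complex.continuous_conj.comp_aestronglyMeasurable hf.1)
    (.of_forall fun x => by simp)

theorem integrable_mul_conj {μ : Measure (Eucl N)} {p q : ℝ≥0∞} [p.HolderConjugate q]
    {f g : Eucl N → ℂ} (hf : MemLp f p μ) (hg : MemLp g q μ) :
    Integrable (fun x => f x * starRingEnd ℂ (g x)) μ :=
  hf.integrable_mul (memLp_conj hg)

theorem memLp_classicalGrad (φ : 𝓓(Ω, ℂ)) (p : ℝ≥0∞) (μ : Measure (Eucl N))
    [IsFiniteMeasureOnCompacts μ] : MemLp (classicalGrad φ) p μ := by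
  refine Continuous.memLp_of_hasCompactSupport ?_ ?_
  · exact (PiLp.continuous_toLp 2 _).comp
      (continuous_pi fun j => (testPartial j φ).continuous)
  · refine HasCompactSupport.of_support_subset_isCompact
      φ.hasCompactSupport.isCompact fun x hx => ?_
    by_contra h
    refine hx ?_
    ext j
    have : x ∉ Function.support (testPartial j φ) :=
      fun h' => h (tsupport_fderiv_apply_subset ℝ _ (subset_tsupport _ h'))
    simpa [classicalGrad, testPartial_apply] using this

/-- Membership in `H¹₀` comes with its own weak gradient, while the estimates are stated for an
arbitrary one; uniqueness identifies the two. -/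
theorem HasWeakGradient.ae_eq {u : Eucl N → ℂ} {Du Dv : Eucl N → CVec N}
    (h : HasWeakGradient Ω u Du) (h' : HasWeakGradient Ω u Dv) : Du =ᵐ[leb Ω] Dv := by
  have hcoord : ∀ j, ∀ᵐ x, x ∈ (Ω : Set (Eucl N)) → Du x j - Dv x j = 0 := by
    intro j
    have hl : ∀ {D : Eucl N → CVec N}, HasWeakGradient Ω u D →
        LocallyIntegrableOn (fun x => D x j) (Ω : Set (Eucl N)) volume := by
      intro D hD x hx
      obtain ⟨s, hs, hi⟩ := hD.locallyIntegrable_grad x hx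
      exact ⟨s, hs, (EuclideanSpace.proj (𝕜 := ℂ) j).integrable_comp hi⟩
    refine Ω.isOpen.ae_eq_zero_of_integral_contDiff_smul_eq_zero ((hl h).sub (hl h')) ?_
    intro g hg hgc hgs
    let φ : 𝓓(Ω, ℂ) :=
      ⟨fun x => (g x : ℂ), Complex.ofRealCLM.contDiff.comp hg, hgc.comp_left Complex.ofReal_zero,
        (tsupport_comp_subset Complex.ofReal_zero _).trans hgs⟩
    have hφ : ∀ x, φ x = (g x : ℂ) := fun _ => rfl
    have hint : ∀ {D : Eucl N → CVec N}, HasWeakGradient Ω u D →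
        Integrable (fun x => g x • D x j) volume := fun hD =>
      (integrableOn_iff_integrable_of_support_subset
        ((Function.support_smul_subset_left _ _).trans (subset_tsupport g))).1
        (((hl hD).integrableOn_compact_subset hgs hgc.isCompact).continuousOn_smul
          hg.continuous.continuousOn hgc.isCompact)
    have hset : ∀ {D : Eucl N → CVec N}, ∫ x in (Ω : Set (Eucl N)), D x j * φ x
        = ∫ x, g x • D x j := by
      intro D
      rw [setIntegral_eq_integral_of_forall_compl_eq_zero]
      · refine integral_congr_ae (.of_forall fun x => ?_)
        simp [hφ, mul_comm]
      · intro x hx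
        have : g x = 0 := by
          by_contra h0
          exact hx (hgs (subset_tsupport _ h0))
        simp [hφ, this]
    have e := (h.integral_eq φ j).symm.trans (h'.integral_eq φ j)
    rw [hset, hset, neg_inj] at e
    simp_rw [smul_sub]
    rw [integral_sub (hint h) (hint h'), e, sub_self]
  rw [EventuallyEq, ae_restrict_iff' Ω.isOpen.measurableSet]
  filter_upwards [ae_all_iff.2 hcoord] with x hx hxΩ
  ext j
  exact sub_eq_zero.1 (hx j hxΩ)

/-! ### The nonlinearity and the weak formulation. -/

theorem norm_singularPower {m : ℝ} (hm : 0 < m) (z : ℂ) : ‖singularPower m z‖ = ‖z‖ ^ m := by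
  unfold singularPower
  split_ifs with h
  · simp [h, Real.zero_rpow hm.ne']
  · have h0 : 0 < ‖z‖ := norm_pos_iff.2 h
    rw [norm_mul, Complex.norm_real, Real.norm_of_nonneg (by positivity),
      ← Real.rpow_add_one h0.ne']
    congr 1; ring

theorem singularPower_mul_conj {m : ℝ} (hm : 0 < m) (z : ℂ) :
    singularPower m z * starRingEnd ℂ z = ((‖z‖ ^ (m + 1) : ℝ) : ℂ) := by
  unfold singularPower
  split_ifs with h
  · simp [h, Real.zero_rpow (by linarith : m + 1 ≠ 0)]
  · have h0 : 0 < ‖z‖ := norm_pos_iff.2 h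
    rw [mul_assoc, Complex.mul_conj, Complex.normSq_eq_norm_sq, ← Complex.ofReal_mul]
    congr 1
    rw [← Real.rpow_natCast, ← Real.rpow_add h0]
    congr 1; push_cast; ring

theorem measurable_singularPower (m : ℝ) : Measurable (singularPower m) := by
  unfold singularPower
  refine Measurable.ite (measurableSet_singleton 0) measurable_const ?_
  fun_prop

theorem memLp_singularPower {μ : Measure (Eucl N)} {m : ℝ} (hm : 0 < m) {u : Eucl N → ℂ}
    (hu : MemLp u (ENNReal.ofReal (m + 1)) μ) :
    MemLp (fun x => singularPower m (u x)) (ENNReal.ofReal ((m + 1) / m)) μ := by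
  -- `|u|^m` lies in `L^{(m+1)/m}`, the dual of `L^{m+1}`, because `u ∈ L^{m+1}`.
  have h := hu.norm_rpow_div (ENNReal.ofReal m)
  rw [ENNReal.toReal_ofReal hm.le, ← ENNReal.ofReal_div_of_pos hm] at h
  refine h.of_le ((measurable_singularPower m).comp_aemeasurable
    hu.1.aemeasurable).aestronglyMeasurable (.of_forall fun x => ?_)
  rw [norm_singularPower hm, Real.norm_of_nonneg (by positivity)]

theorem holderConjugate_ofReal {m : ℝ} (hm : 0 < m) :
    (ENNReal.ofReal ((m + 1) / m)).HolderConjugate (ENNReal.ofReal (m + 1)) := by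
  refine Real.HolderConjugate.ennrealOfReal ?_
  rw [Real.holderConjugate_iff]
  constructor
  · rw [lt_div_iff₀ hm]; linarith
  · field_simp

/-- The sesquilinear pairing `∫_Ω G f̄`. -/
noncomputable def conjPairing (Ω : Opens (Eucl N)) (G f : Eucl N → ℂ) : ℂ :=
  ∫ x in (Ω : Set (Eucl N)), G x * starRingEnd ℂ (f x)

theorem conjPairing_smul_right (G f : Eucl N → ℂ) (c : ℂ) :
    conjPairing Ω G (fun x => c * f x) = starRingEnd ℂ c * conjPairing Ω G f := by
  unfold conjPairing
  rw [← integral_const_mul]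
  refine integral_congr_ae (.of_forall fun x => ?_)
  simp only [map_mul]
  ring

theorem HasWeakGradient.conjPairing_partialDeriv {u : Eucl N → ℂ} {Du : Eucl N → CVec N}
    (hD : HasWeakGradient Ω u Du) (φ : 𝓓(Ω, ℂ)) (j : Fin N) :
    conjPairing Ω u (partialDeriv j φ) = -conjPairing Ω (fun x => Du x j) φ := by
  refine Eq.trans ?_ (hD.integral_eq (testConj φ) j)
  refine integral_congr_ae (.of_forall fun x => ?_)
  simp only
  rw [← partialDeriv_conj j (differentiable_test φ)]
  rfl

/-- The weak formulation of the equation, as a complex identity. -/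
theorem IsLocalWeakSolution.weak_form {m : ℝ} (hm : 0 < m) {a b : ℂ} {F u : Eucl N → ℂ}
    {Du : Eucl N → CVec N} (h : IsLocalWeakSolution Ω m a b F u) (hD : HasWeakGradient Ω u Du)
    (hu : MemLp u (ENNReal.ofReal (m + 1)) (leb Ω)) (hu2 : MemLp u 2 (leb Ω)) (φ : 𝓓(Ω, ℂ)) :
    Complex.I * ∑ j, conjPairing Ω (fun x => Du x j) (partialDeriv j φ)
      + a * conjPairing Ω (fun x => singularPower m (u x)) φ + b * conjPairing Ω u φ
      = conjPairing Ω F φ := by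
  have := holderConjugate_ofReal hm
  set T : 𝓓(Ω, ℂ) → ℂ := fun φ =>
    Complex.I * ∑ j, conjPairing Ω (fun x => Du x j) (partialDeriv j φ)
      + a * conjPairing Ω (fun x => singularPower m (u x)) φ + b * conjPairing Ω u φ
      - conjPairing Ω F φ with hT
  have hre : ∀ φ, (T φ).re = 0 := by
    intro φ
    have i1 : ∀ j, Integrable (fun x =>
        u x * starRingEnd ℂ (partialDeriv j (partialDeriv j φ) x)) (leb Ω) := fun j =>
      integrable_mul_conj hu2 (memLp_test (testPartial j (testPartial j φ)) 2 _)
    have i2 := integrable_mul_conj (memLp_singularPower hm hu)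
      (memLp_test φ (ENNReal.ofReal (m + 1)) (leb Ω))
    have i3 := integrable_mul_conj hu2 (memLp_test φ 2 (leb Ω))
    have heq := h.equation φ
    have e : ∫ x in (Ω : Set (Eucl N)),
        (-Complex.I * u x * starRingEnd ℂ (Δ (φ : Eucl N → ℂ) x)
          + (a * singularPower m (u x) + b * u x) * starRingEnd ℂ (φ x))
        = T φ + conjPairing Ω F φ := by
      have e1 : ∀ x, (-Complex.I * u x * starRingEnd ℂ (Δ (φ : Eucl N → ℂ) x)
          + (a * singularPower m (u x) + b * u x) * starRingEnd ℂ (φ x))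
          = (-Complex.I * ∑ j, u x * starRingEnd ℂ (partialDeriv j (partialDeriv j φ) x)
            + a * (singularPower m (u x) * starRingEnd ℂ (φ x)))
            + b * (u x * starRingEnd ℂ (φ x)) := by
        intro x
        rw [laplacian_test, map_sum, ← Finset.mul_sum]
        ring
      simp_rw [e1]
      rw [integral_add _ (i3.const_mul b), integral_add _ (i2.const_mul a),
        integral_const_mul, integral_const_mul, integral_const_mul, integral_finsetSum]
      -- One derivative of the Laplacian is moved onto `u`, using the weak gradient against the test
      -- function `∂ⱼφ`.
      · have h2 := fun j => hD.conjPairing_partialDeriv (testPartial j φ) j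
        change -Complex.I * ∑ j, conjPairing Ω u (partialDeriv j (partialDeriv j φ))
          + a * conjPairing Ω (fun x => singularPower m (u x)) φ + b * conjPairing Ω u φ = _
        have h3 : ∀ j, conjPairing Ω u (partialDeriv j (partialDeriv j φ))
          = -conjPairing Ω (fun x => Du x j) (partialDeriv j φ) := h2
        simp_rw [h3, hT]
        rw [Finset.sum_neg_distrib]
        ring
      · exact fun j _ => i1 j
      · exact (integrable_finsetSum _ fun j _ => i1 j).const_mul _
      · exact ((integrable_finsetSum _ fun j _ => i1 j).const_mul _).add (i2.const_mul a)
    rw [e, Complex.add_re] at heq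
    change _ = (conjPairing Ω F φ).re at heq
    linarith
  -- The equation only equates real parts. As `T` is conjugate-homogeneous, the real part of `T
  -- (iφ)` is the imaginary part of `T φ`, which therefore vanishes too.
  have hsmul : T (Complex.I • φ) = -Complex.I * T φ := by
    have s2 : ⇑(Complex.I • φ) = fun x => Complex.I * φ x := rfl
    have s3 : ∀ j, partialDeriv j (Complex.I • φ) = fun x => Complex.I * partialDeriv j φ x :=
      fun j => funext fun x => partialDeriv_const_smul j _ (differentiable_test φ) x
    simp only [hT]
    simp_rw [s3, s2, conjPairing_smul_right, Complex.conj_I]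
    rw [← Finset.mul_sum]
    ring
  have him := hre (Complex.I • φ)
  rw [hsmul] at him
  have : T φ = 0 := Complex.ext (hre φ) (by simpa using him)
  exact sub_eq_zero.1 this

theorem eLpNorm_mul_conj_le {μ : Measure (Eucl N)} {p q : ℝ≥0∞} [p.HolderConjugate q]
    {f g : Eucl N → ℂ} (hf : MemLp f p μ) (hg : MemLp g q μ) :
    eLpNorm (fun x => f x * starRingEnd ℂ (g x)) 1 μ ≤ eLpNorm f p μ * eLpNorm g q μ := by
  have h := eLpNorm_smul_le_mul_eLpNorm (p := p) (q := q) (r := 1) (memLp_conj hg).1 hf.1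
  have e : eLpNorm (fun x => starRingEnd ℂ (g x)) q μ = eLpNorm g q μ :=
    eLpNorm_congr_norm_ae (.of_forall fun x => by simp)
  rw [e] at h
  exact h

/-- `∫_Ω G f̄ₙ → ∫_Ω G f̄` when `fₙ → f` in the dual Lebesgue space. -/
theorem tendsto_conjPairing {p q : ℝ≥0∞} [hpq : p.HolderConjugate q] {G f : Eucl N → ℂ}
    {g : ℕ → Eucl N → ℂ} (hG : MemLp G p (leb Ω)) (hf : MemLp f q (leb Ω))
    (hg : ∀ n, MemLp (g n) q (leb Ω))
    (h : Tendsto (fun n => eLpNorm (fun x => f x - g n x) q (leb Ω)) atTop (𝓝 0)) :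
    Tendsto (fun n => conjPairing Ω G (g n)) atTop (𝓝 (conjPairing Ω G f)) := by
  refine tendsto_integral_of_L1' _ (integrable_mul_conj hG hf).1
    (.of_forall fun n => integrable_mul_conj hG (hg n)) ?_
  have h2 : Tendsto (fun n => eLpNorm G p (leb Ω) * eLpNorm (fun x => f x - g n x) q (leb Ω))
      atTop (𝓝 0) := by
    simpa using ENNReal.Tendsto.const_mul h (Or.inr hG.eLpNorm_ne_top)
  refine tendsto_of_tendsto_of_tendsto_of_le_of_le tendsto_const_nhds h2 (fun _ => bot_le) ?_
  intro n
  refine le_trans (le_of_eq ?_) (eLpNorm_mul_conj_le hG (hf.sub (hg n)))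
  rw [← eLpNorm_neg]
  refine eLpNorm_congr_ae (.of_forall fun x => ?_)
  simp only [Pi.neg_apply, Pi.sub_apply, map_sub]
  ring

/-! ### Cutoffs and simultaneous approximation in `H¹` and `L^p`. -/

/-- The product of a smooth real function and a test function, as a test function. -/
noncomputable def testMul (η : Eucl N → ℝ) (hη : ContDiff ℝ ((⊤ : ℕ∞) : WithTop ℕ∞) η)
    (φ : 𝓓(Ω, ℂ)) : 𝓓(Ω, ℂ) where
  toFun x := (η x : ℂ) * φ x
  contDiff' := (Complex.ofRealCLM.contDiff.comp hη).mul φ.contDiff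
  hasCompactSupport' := φ.hasCompactSupport.mul_left
  tsupport_subset' := tsupport_mul_subset_right.trans φ.tsupport_subset

theorem testMul_apply {η : Eucl N → ℝ} (hη : ContDiff ℝ ((⊤ : ℕ∞) : WithTop ℕ∞) η)
    (φ : 𝓓(Ω, ℂ)) (x : Eucl N) : testMul η hη φ x = (η x : ℂ) * φ x := rfl

/-- The gradient of a real function, with values in `ℂ^N`. -/
noncomputable def realGrad (η : Eucl N → ℝ) (x : Eucl N) : CVec N :=
  WithLp.toLp 2 (fun j => ((fderiv ℝ η x (EuclideanSpace.single j (1 : ℝ)) : ℝ) : ℂ))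

theorem classicalGrad_testMul {η : Eucl N → ℝ} (hη : ContDiff ℝ ((⊤ : ℕ∞) : WithTop ℕ∞) η)
    (φ : 𝓓(Ω, ℂ)) (x : Eucl N) : classicalGrad (testMul η hη φ) x
      = (η x : ℂ) • classicalGrad φ x + φ x • realGrad η x := by
  ext j
  have h1 : HasFDerivAt (fun y => (η y : ℂ)) (Complex.ofRealCLM.comp (fderiv ℝ η x)) x :=
    Complex.ofRealCLM.hasFDerivAt.comp x (hη.differentiable (by simp) x).hasFDerivAt
  have h2 := h1.mul (differentiable_test φ x).hasFDerivAt
  have h3 : fderiv ℝ (testMul η hη φ) x = _ := h2.fderiv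
  simp [classicalGrad, partialDeriv, realGrad, h3]

theorem continuous_realGrad {η : Eucl N → ℝ} (hη : ContDiff ℝ 1 η) : Continuous (realGrad η) :=
  (PiLp.continuous_toLp 2 _).comp (continuous_pi fun _ => Complex.continuous_ofReal.comp
    ((hη.continuous_fderiv (by simp)).clm_apply continuous_const))

/-- A smooth function equal to `1` on the unit ball and supported in the ball of radius `2`. -/
noncomputable def unitBump (N : ℕ) : ContDiffBump (0 : Eucl N) where
  rIn := 1
  rOut := 2
  rIn_pos := one_pos
  rIn_lt_rOut := one_lt_two

/-- Smooth cutoff functions exhausting `ℝ^N`. -/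
noncomputable def cutoff (N k : ℕ) (x : Eucl N) : ℝ := unitBump N (((k : ℝ) + 1)⁻¹ • x)

theorem contDiff_cutoff (k : ℕ) : ContDiff ℝ ((⊤ : ℕ∞) : WithTop ℕ∞) (cutoff N k) :=
  (unitBump N).contDiff.comp (contDiff_const_smul _)

theorem cutoff_nonneg (k : ℕ) (x : Eucl N) : 0 ≤ cutoff N k x := (unitBump N).nonneg

theorem cutoff_le_one (k : ℕ) (x : Eucl N) : cutoff N k x ≤ 1 := (unitBump N).le_one

theorem cutoff_eq_zero {k : ℕ} {x : Eucl N} (hx : x ∉ Metric.ball 0 (2 * ((k : ℝ) + 1))) :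
    cutoff N k x = 0 := by
  have hk : (0 : ℝ) < (k : ℝ) + 1 := by positivity
  refine (unitBump N).zero_of_le_dist ?_
  rw [Metric.mem_ball, dist_zero_right, not_lt] at hx
  rw [dist_zero_right, norm_smul, norm_inv, Real.norm_of_nonneg hk.le, inv_mul_eq_div]
  exact (le_div_iff₀ hk).2 hx

theorem eventually_cutoff_eq_one (x : Eucl N) : ∀ᶠ k in atTop, cutoff N k x = 1 := by
  obtain ⟨n, hn⟩ := exists_nat_ge ‖x‖
  filter_upwards [eventually_ge_atTop n] with k hk
  have hk0 : (0 : ℝ) < (k : ℝ) + 1 := by positivity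
  refine (unitBump N).one_of_mem_closedBall ?_
  rw [Metric.mem_closedBall, dist_zero_right, norm_smul, norm_inv, Real.norm_of_nonneg hk0.le,
    inv_mul_eq_div]
  refine (div_le_one hk0).2 ?_
  have : (n : ℝ) ≤ k := by exact_mod_cast hk
  linarith

/-- By scaling, the gradient of the `k`-th cutoff is `1/(k+1)` times a dilate of one fixed bounded
gradient. -/
theorem exists_norm_realGrad_cutoff_le (N : ℕ) :
    ∃ K : ℝ, 0 ≤ K ∧ ∀ k (x : Eucl N), ‖realGrad (cutoff N k) x‖ ≤ K / ((k : ℝ) + 1) := by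
  have hc : Continuous (realGrad (unitBump N)) := continuous_realGrad (unitBump N).contDiff
  have hs : HasCompactSupport (realGrad (unitBump N)) := by
    refine HasCompactSupport.of_support_subset_isCompact
      (unitBump N).hasCompactSupport.isCompact fun x hx => ?_
    by_contra h
    refine hx ?_
    have : fderiv ℝ (unitBump N) x = 0 := by
      by_contra h0
      exact h (tsupport_fderiv_subset ℝ (subset_tsupport _ h0))
    ext j
    simp [realGrad, this]
  obtain ⟨K, hK⟩ := hc.bounded_above_of_compact_support hs
  refine ⟨K, (norm_nonneg _).trans (hK 0), fun k x => ?_⟩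
  have hk0 : (0 : ℝ) < (k : ℝ) + 1 := by positivity
  have e : realGrad (cutoff N k) x
      = ((((k : ℝ) + 1)⁻¹ : ℝ) : ℂ) • realGrad (unitBump N) (((k : ℝ) + 1)⁻¹ • x) := by
    have hd : HasFDerivAt (cutoff N k) ((fderiv ℝ (unitBump N) (((k : ℝ) + 1)⁻¹ • x)).comp
        (((k : ℝ) + 1)⁻¹ • ContinuousLinearMap.id ℝ (Eucl N))) x :=
      HasFDerivAt.comp (g := unitBump N) x
        (((unitBump N).contDiff (n := 1)).differentiable (by simp) _).hasFDerivAt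
        (((((k : ℝ) + 1)⁻¹ • ContinuousLinearMap.id ℝ (Eucl N)) :
          Eucl N →L[ℝ] Eucl N).hasFDerivAt (x := x))
    ext j
    simp [realGrad, hd.fderiv]
  rw [e, norm_smul, Complex.norm_real, norm_inv, Real.norm_of_nonneg hk0.le, inv_mul_eq_div]
  exact div_le_div_of_nonneg_right (hK _) hk0.le

theorem tendsto_eLpNorm_one_sub_cutoff {V : Type*} [NormedAddCommGroup V] [NormedSpace ℂ V]
    {μ : Measure (Eucl N)} {p : ℝ≥0∞} (hp0 : p ≠ 0) (hp : p ≠ ⊤) {f : Eucl N → V}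
    (hf : MemLp f p μ) :
    Tendsto (fun k => eLpNorm (fun x => ((1 - cutoff N k x : ℝ) : ℂ) • f x) p μ) atTop (𝓝 0) := by
  have hpr := ENNReal.toReal_pos hp0 hp
  simp_rw [eLpNorm_eq_lintegral_rpow_enorm_toReal hp0 hp]
  have key : Tendsto (fun k => ∫⁻ x, ‖((1 - cutoff N k x : ℝ) : ℂ) • f x‖ₑ ^ p.toReal ∂μ) atTop
      (𝓝 (∫⁻ _, 0 ∂μ)) := by
    refine tendsto_lintegral_of_dominated_convergence' (fun x => ‖f x‖ₑ ^ p.toReal) ?_ ?_ ?_ ?_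
    · intro k
      have : Continuous fun x => ((1 - cutoff N k x : ℝ) : ℂ) :=
        Complex.continuous_ofReal.comp (continuous_const.sub (contDiff_cutoff k).continuous)
      exact ((this.aestronglyMeasurable.smul hf.1).enorm).pow_const _
    · intro k
      refine .of_forall fun x => ENNReal.rpow_le_rpow ?_ hpr.le
      rw [enorm_smul]
      refine mul_le_of_le_one_left bot_le ?_
      rw [← ofReal_norm, Complex.norm_real, Real.norm_of_nonneg
        (sub_nonneg.2 (cutoff_le_one k x)), ENNReal.ofReal_le_one]
      linarith [cutoff_nonneg k x]
    · exact (lintegral_rpow_enorm_lt_top_of_eLpNorm_lt_top hp0 hp hf.2).ne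
    · refine .of_forall fun x => tendsto_const_nhds.congr' ?_
      filter_upwards [eventually_cutoff_eq_one x] with k hk
      simp [hk, hpr]
  rw [lintegral_zero] at key
  have := key.ennrpow_const (1 / p.toReal)
  rwa [ENNReal.zero_rpow_of_pos (by positivity)] at this

theorem eLpNorm_cutoff_smul_le {V : Type*} [NormedAddCommGroup V] [NormedSpace ℂ V]
    {μ : Measure (Eucl N)} {p : ℝ≥0∞} (k : ℕ) (f : Eucl N → V) :
    eLpNorm (fun x => (cutoff N k x : ℂ) • f x) p μ ≤ eLpNorm f p μ := by
  refine eLpNorm_mono fun x => ?_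
  rw [norm_smul, Complex.norm_real, Real.norm_of_nonneg (cutoff_nonneg k x)]
  exact mul_le_of_le_one_left (norm_nonneg _) (cutoff_le_one k x)

/-- The cutoff localizes to a ball, where Hölder's inequality trades the larger exponent for the
smaller one at the price of a power of the measure of the ball. -/
theorem eLpNorm_cutoff_smul_le_mul {V : Type*} [NormedAddCommGroup V] [NormedSpace ℂ V]
    {μ : Measure (Eucl N)} {p q : ℝ≥0∞} (hpq : p ≤ q) (k : ℕ) {f : Eucl N → V}
    (hf : AEStronglyMeasurable f μ) :
    eLpNorm (fun x => (cutoff N k x : ℂ) • f x) p μ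
      ≤ eLpNorm f q μ *
        μ (Metric.ball 0 (2 * ((k : ℝ) + 1))) ^ (1 / p.toReal - 1 / q.toReal) := by
  set B : Set (Eucl N) := Metric.ball 0 (2 * ((k : ℝ) + 1))
  have hB : MeasurableSet B := measurableSet_ball
  calc eLpNorm (fun x => (cutoff N k x : ℂ) • f x) p μ ≤ eLpNorm (B.indicator f) p μ := by
        refine eLpNorm_mono fun x => ?_
        by_cases hx : x ∈ B
        · rw [Set.indicator_of_mem hx, norm_smul, Complex.norm_real,
            Real.norm_of_nonneg (cutoff_nonneg k x)]
          exact mul_le_of_le_one_left (norm_nonneg _) (cutoff_le_one k x)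
        · simp [cutoff_eq_zero hx]
    _ = eLpNorm f p (μ.restrict B) := eLpNorm_indicator_eq_eLpNorm_restrict hB
    _ ≤ _ := eLpNorm_le_eLpNorm_mul_rpow_measure_univ hpq hf.restrict
    _ ≤ _ := by
        rw [Measure.restrict_apply_univ]
        gcongr
        exact Measure.restrict_le_self

/-- Test functions are dense in `H¹₀(Ω) ∩ L^p(Ω)` for `1 ≤ p ≤ 2`. -/
theorem exists_test_tendsto {p : ℝ≥0∞} (hp1 : 1 ≤ p) (hp2 : p ≤ 2) {u : Eucl N → ℂ}
    {Du : Eucl N → CVec N} (hu : MemLp u 2 (leb Ω)) (hDu : MemLp Du 2 (leb Ω))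
    (hup : MemLp u p (leb Ω)) {φ : ℕ → 𝓓(Ω, ℂ)}
    (h1 : Tendsto (fun n => eLpNorm (fun x => u x - φ n x) 2 (leb Ω)) atTop (𝓝 0))
    (h2 : Tendsto (fun n => eLpNorm (fun x => Du x - classicalGrad (φ n) x) 2 (leb Ω)) atTop
      (𝓝 0)) :
    ∃ ψ : ℕ → 𝓓(Ω, ℂ),
      Tendsto (fun n => eLpNorm (fun x => u x - ψ n x) 2 (leb Ω)) atTop (𝓝 0) ∧
      Tendsto (fun n => eLpNorm (fun x => Du x - classicalGrad (ψ n) x) 2 (leb Ω)) atTop (𝓝 0) ∧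
      Tendsto (fun n => eLpNorm (fun x => u x - ψ n x) p (leb Ω)) atTop (𝓝 0) := by
  have hp0 : p ≠ 0 := (one_pos.trans_le hp1).ne'
  have hpt : p ≠ ⊤ := (hp2.trans_lt (by simp)).ne
  set c : ℕ → ℝ≥0∞ := fun k =>
    leb Ω (Metric.ball 0 (2 * ((k : ℝ) + 1))) ^ (1 / p.toReal - 1 / (2 : ℝ≥0∞).toReal) with hc
  have hct : ∀ k, c k ≠ ⊤ := by
    intro k
    refine ENNReal.rpow_ne_top_of_nonneg ?_ measure_ball_lt_top.ne
    rw [sub_nonneg]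
    exact one_div_le_one_div_of_le (ENNReal.toReal_pos hp0 hpt) (ENNReal.toReal_mono (by simp) hp2)
  -- Diagonal choice: the `L²` error must remain small even after multiplication by `c k`, the
  -- Hölder loss on the `k`-th ball. For `k = 0` the bound is `⊤` and says nothing.
  have hsel : ∀ k : ℕ, ∃ n, eLpNorm (fun x => u x - φ n x) 2 (leb Ω) ≤ (k : ℝ≥0∞)⁻¹ ∧
      eLpNorm (fun x => Du x - classicalGrad (φ n) x) 2 (leb Ω) ≤ (k : ℝ≥0∞)⁻¹ ∧
      eLpNorm (fun x => u x - φ n x) 2 (leb Ω) * c k ≤ (k : ℝ≥0∞)⁻¹ := by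
    intro k
    have hk : (0 : ℝ≥0∞) < (k : ℝ≥0∞)⁻¹ := ENNReal.inv_pos.2 (ENNReal.natCast_ne_top k)
    have h3 : Tendsto (fun n => eLpNorm (fun x => u x - φ n x) 2 (leb Ω) * c k) atTop (𝓝 0) := by
      simpa using ENNReal.Tendsto.mul_const h1 (Or.inr (hct k))
    exact ((h1.eventually (Iic_mem_nhds hk)).and
      ((h2.eventually (Iic_mem_nhds hk)).and (h3.eventually (Iic_mem_nhds hk)))).exists
  choose s hs1 hs2 hs3 using hsel
  obtain ⟨K, hK0, hK⟩ := exists_norm_realGrad_cutoff_le N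
  have hinv := ENNReal.tendsto_inv_nat_nhds_zero
  have hmeas : ∀ k, AEStronglyMeasurable (fun x => u x - φ (s k) x) (leb Ω) := fun k =>
    hu.1.sub (φ (s k)).continuous.aestronglyMeasurable
  have hcutc : ∀ k, Continuous fun x => (cutoff N k x : ℂ) := fun k =>
    Complex.continuous_ofReal.comp (contDiff_cutoff k).continuous
  have hcutc' : ∀ k, Continuous fun x => ((1 - cutoff N k x : ℝ) : ℂ) := fun k =>
    Complex.continuous_ofReal.comp (continuous_const.sub (contDiff_cutoff k).continuous)
  -- With cutoff `η`, `u - ηφ = (1 - η)u + η(u - φ)`: a tail of `u` plus a localized error.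
  have hsplit : ∀ q : ℝ≥0∞, 1 ≤ q → ∀ k,
      eLpNorm (fun x => u x - testMul (cutoff N k) (contDiff_cutoff k) (φ (s k)) x) q (leb Ω)
      ≤ eLpNorm (fun x => ((1 - cutoff N k x : ℝ) : ℂ) • u x) q (leb Ω)
        + eLpNorm (fun x => (cutoff N k x : ℂ) • (u x - φ (s k) x)) q (leb Ω) := by
    intro q hq k
    refine le_trans (le_of_eq ?_) (eLpNorm_add_le ((hcutc' k).aestronglyMeasurable.smul hu.1)
      ((hcutc k).aestronglyMeasurable.smul (hmeas k)) hq)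
    congr 1
    ext x
    simp [testMul_apply]
    ring
  refine ⟨fun k => testMul (cutoff N k) (contDiff_cutoff k) (φ (s k)), ?_, ?_, ?_⟩
  · have := (tendsto_eLpNorm_one_sub_cutoff two_ne_zero (by simp) hu).add hinv
    rw [add_zero] at this
    refine tendsto_of_tendsto_of_tendsto_of_le_of_le tendsto_const_nhds this
      (fun _ => bot_le) fun k => (hsplit 2 (by simp) k).trans ?_
    exact add_le_add le_rfl ((eLpNorm_cutoff_smul_le k _).trans (hs1 k))
  · have hKt : Tendsto (fun k : ℕ => ENNReal.ofReal (K / ((k : ℝ) + 1))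
        * (eLpNorm u 2 (leb Ω) + (k : ℝ≥0∞)⁻¹)) atTop (𝓝 0) := by
      have t1 : Tendsto (fun k : ℕ => ENNReal.ofReal (K / ((k : ℝ) + 1))) atTop (𝓝 0) := by
        rw [← ENNReal.ofReal_zero]
        refine ENNReal.tendsto_ofReal ?_
        have := (tendsto_one_div_add_atTop_nhds_zero_nat (𝕜 := ℝ)).const_mul K
        simpa [mul_one_div, div_eq_mul_inv] using this
      have t2 : Tendsto (fun k : ℕ => eLpNorm u 2 (leb Ω) + (k : ℝ≥0∞)⁻¹) atTop
          (𝓝 (eLpNorm u 2 (leb Ω) + 0)) := hinv.const_add _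
      have := ENNReal.Tendsto.mul t1 (Or.inr (by simpa using hu.eLpNorm_ne_top)) t2
        (Or.inr ENNReal.zero_ne_top)
      simpa using this
    have := ((tendsto_eLpNorm_one_sub_cutoff two_ne_zero (by simp) hDu).add hinv).add hKt
    rw [add_zero, add_zero] at this
    refine tendsto_of_tendsto_of_tendsto_of_le_of_le tendsto_const_nhds this
      (fun _ => bot_le) fun k => ?_
    have hg : AEStronglyMeasurable (classicalGrad (φ (s k))) (leb Ω) :=
      (memLp_classicalGrad (φ (s k)) 2 _).1
    have m1 : AEStronglyMeasurable (fun x => ((1 - cutoff N k x : ℝ) : ℂ) • Du x) (leb Ω) :=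
      (hcutc' k).aestronglyMeasurable.smul hDu.1
    have m2 : AEStronglyMeasurable
        (fun x => (cutoff N k x : ℂ) • (Du x - classicalGrad (φ (s k)) x)) (leb Ω) :=
      (hcutc k).aestronglyMeasurable.smul (hDu.1.sub hg)
    have m3 : AEStronglyMeasurable
        (fun x => φ (s k) x • realGrad (cutoff N k) x) (leb Ω) :=
      (φ (s k)).continuous.aestronglyMeasurable.smul
        (continuous_realGrad ((contDiff_cutoff k).of_le (by norm_cast))).aestronglyMeasurable
    -- Besides tail and error, the product rule leaves `φ∇η`, which is `O(1/k)` times `‖φ‖₂`, with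
    -- `‖φ‖₂ ≤ ‖u‖₂ + 1/k`.
    have e : (fun x => Du x - classicalGrad
        (testMul (cutoff N k) (contDiff_cutoff k) (φ (s k))) x)
        = ((fun x => ((1 - cutoff N k x : ℝ) : ℂ) • Du x)
          + fun x => (cutoff N k x : ℂ) • (Du x - classicalGrad (φ (s k)) x))
          - fun x => φ (s k) x • realGrad (cutoff N k) x := by
      ext x j
      simp [classicalGrad_testMul]
      ring
    change eLpNorm (fun x => Du x - classicalGrad
        (testMul (cutoff N k) (contDiff_cutoff k) (φ (s k))) x) 2 (leb Ω) ≤ _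
    rw [e]
    refine (eLpNorm_sub_le (m1.add m2) m3 (by simp)).trans (add_le_add
      ((eLpNorm_add_le m1 m2 (by simp)).trans
        (add_le_add le_rfl ((eLpNorm_cutoff_smul_le k _).trans (hs2 k)))) ?_)
    have hφ : eLpNorm (φ (s k)) 2 (leb Ω) ≤ eLpNorm u 2 (leb Ω) + (k : ℝ≥0∞)⁻¹ := by
      have e2 : ⇑(φ (s k)) = u - fun x => u x - φ (s k) x := by ext x; simp
      calc eLpNorm (φ (s k)) 2 (leb Ω) = eLpNorm (u - fun x => u x - φ (s k) x) 2 (leb Ω) := by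
            rw [← e2]
        _ ≤ _ := eLpNorm_sub_le hu.1 (hmeas k) (by simp)
        _ ≤ _ := add_le_add le_rfl (hs1 k)
    refine le_trans ?_ (mul_le_mul_right hφ _)
    refine eLpNorm_le_mul_eLpNorm_of_ae_le_mul (.of_forall fun x => ?_) 2
    rw [norm_smul, mul_comm]
    exact mul_le_mul_of_nonneg_right (hK k x) (norm_nonneg _)
  · have := (tendsto_eLpNorm_one_sub_cutoff hp0 hpt hup).add hinv
    rw [add_zero] at this
    refine tendsto_of_tendsto_of_tendsto_of_le_of_le tendsto_const_nhds this
      (fun _ => bot_le) fun k => (hsplit p hp1 k).trans ?_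
    exact add_le_add le_rfl ((eLpNorm_cutoff_smul_le_mul hp2 k (hmeas k)).trans (hs3 k))

/-! ### Gagliardo–Nirenberg inequality by averaging translates. -/

/-- A real direction, viewed in `ℂ^N`, pairs with the gradient to give the directional derivative,
so Cauchy–Schwarz applies with constant `1`. -/
theorem norm_fderiv_apply_le (φ : Eucl N → ℂ) (x h : Eucl N) :
    ‖fderiv ℝ φ x h‖ ≤ ‖h‖ * ‖classicalGrad φ x‖ := by
  set k : CVec N := WithLp.toLp 2 (fun j => (h j : ℂ)) with hk
  have hn : ‖k‖ = ‖h‖ := by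
    rw [EuclideanSpace.norm_eq, EuclideanSpace.norm_eq]
    simp [hk]
  have hs : h = ∑ j, h j • EuclideanSpace.single j (1 : ℝ) := by
    ext i
    simp [Finset.sum_apply, Pi.single_apply]
  have he : fderiv ℝ φ x h = inner ℂ k (classicalGrad φ x) := by
    conv_lhs => rw [hs]
    rw [map_sum, PiLp.inner_apply]
    refine Finset.sum_congr rfl fun j _ => ?_
    simp [hk, classicalGrad, partialDeriv, mul_comm]
  rw [he, ← hn]
  exact norm_inner_le_norm _ _

theorem lintegral_rpow_two_le {α : Type*} [MeasurableSpace α] {μ : Measure α}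
    [IsProbabilityMeasure μ] {f : α → ℝ≥0∞} (hf : AEMeasurable f μ) :
    (∫⁻ a, f a ∂μ) ^ (2 : ℝ) ≤ ∫⁻ a, f a ^ (2 : ℝ) ∂μ := by
  have h := ENNReal.lintegral_mul_norm_pow_le (hf.pow_const (2 : ℝ))
    (aemeasurable_const (b := (1 : ℝ≥0∞)) (μ := μ)) (p := 1 / 2) (q := 1 / 2) (by norm_num)
    (by norm_num) (by norm_num)
  have e : ∀ a, (f a ^ (2 : ℝ)) ^ (1 / 2 : ℝ) = f a := by
    intro a
    rw [← ENNReal.rpow_mul]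
    norm_num
  simp only [e, ENNReal.one_rpow, mul_one, lintegral_one, measure_univ] at h
  calc (∫⁻ a, f a ∂μ) ^ (2 : ℝ) ≤ ((∫⁻ a, f a ^ (2 : ℝ) ∂μ) ^ (1 / 2 : ℝ)) ^ (2 : ℝ) :=
        ENNReal.rpow_le_rpow h (by norm_num)
    _ = _ := by rw [← ENNReal.rpow_mul]; norm_num

/-- Translates of a test function: `‖φ(· + h) - φ‖₂ ≤ |h| ‖∇φ‖₂`. -/
theorem lintegral_enorm_sub_translate_le (φ : 𝓓(Ω, ℂ)) (h : Eucl N) :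
    ∫⁻ x, ‖φ (x + h) - φ x‖ₑ ^ (2 : ℝ)
      ≤ ‖h‖ₑ ^ (2 : ℝ) * ∫⁻ x, ‖classicalGrad φ x‖ₑ ^ (2 : ℝ) := by
  have hcf : Continuous (fderiv ℝ φ) := φ.contDiff.continuous_fderiv (by simp)
  have hcg : Continuous (classicalGrad φ) :=
    (PiLp.continuous_toLp 2 _).comp (continuous_pi fun j => (testPartial j φ).continuous)
  -- `φ(x + h) - φ(x)` is the mean over `t ∈ (0, 1]` of the derivative along the segment; Jensen,
  -- Tonelli and translation invariance then give the bound.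
  set ν : Measure ℝ := volume.restrict (Set.Ioc 0 1) with hν
  have : IsProbabilityMeasure ν := ⟨by simp [hν]⟩
  have hpt : ∀ x, ‖φ (x + h) - φ x‖ₑ ^ (2 : ℝ)
      ≤ ∫⁻ t, ‖h‖ₑ ^ (2 : ℝ) * ‖classicalGrad φ (x + t • h)‖ₑ ^ (2 : ℝ) ∂ν := by
    intro x
    have hd : ∀ t : ℝ, HasDerivAt (fun t : ℝ => φ (x + t • h)) (fderiv ℝ φ (x + t • h) h) t := by
      intro t
      have h1 : HasDerivAt (fun t : ℝ => x + t • h) h t := by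
        simpa using ((hasDerivAt_id t).smul_const h).const_add x
      exact (differentiable_test φ (x + t • h)).hasFDerivAt.comp_hasDerivAt t h1
    have hc : Continuous fun t : ℝ => fderiv ℝ φ (x + t • h) h :=
      (hcf.comp (by fun_prop)).clm_apply continuous_const
    have hi := intervalIntegral.integral_eq_sub_of_hasDerivAt (a := 0) (b := 1)
      (fun t _ => hd t) (hc.intervalIntegrable 0 1)
    rw [one_smul, zero_smul, add_zero, intervalIntegral.integral_of_le zero_le_one] at hi
    rw [← hi]
    refine (ENNReal.rpow_le_rpow (enorm_integral_le_lintegral_enorm _) (by norm_num)).trans ?_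
    refine (lintegral_rpow_two_le hc.aestronglyMeasurable.enorm).trans ?_
    refine lintegral_mono fun t => ?_
    rw [← ENNReal.mul_rpow_of_nonneg _ _ (by norm_num)]
    refine ENNReal.rpow_le_rpow ?_ (by norm_num)
    rw [← ofReal_norm, ← ofReal_norm, ← ofReal_norm, ← ENNReal.ofReal_mul (norm_nonneg _)]
    exact ENNReal.ofReal_le_ofReal (norm_fderiv_apply_le _ _ _)
  calc ∫⁻ x, ‖φ (x + h) - φ x‖ₑ ^ (2 : ℝ)
      ≤ ∫⁻ x, ∫⁻ t, ‖h‖ₑ ^ (2 : ℝ) * ‖classicalGrad φ (x + t • h)‖ₑ ^ (2 : ℝ) ∂ν :=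
        lintegral_mono hpt
    _ = ∫⁻ t, (∫⁻ x, ‖h‖ₑ ^ (2 : ℝ) * ‖classicalGrad φ (x + t • h)‖ₑ ^ (2 : ℝ)) ∂ν := by
        refine lintegral_lintegral_swap (Measurable.aemeasurable ?_)
        refine Measurable.const_mul (Measurable.pow_const (Continuous.measurable ?_) _) _
        exact (hcg.comp (by fun_prop)).enorm
    _ = ∫⁻ _, (‖h‖ₑ ^ (2 : ℝ) * ∫⁻ x, ‖classicalGrad φ x‖ₑ ^ (2 : ℝ)) ∂ν := by
        refine lintegral_congr fun t => ?_
        rw [lintegral_const_mul _ (by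
          exact ((hcg.comp (by fun_prop)).enorm.measurable).pow_const _)]
        congr 1
        exact lintegral_add_right_eq_self (fun x => ‖classicalGrad φ x‖ₑ ^ (2 : ℝ)) (t • h)
    _ = _ := by simp

theorem add_rpow_two_le (s t : ℝ≥0∞) :
    (s + t) ^ (2 : ℝ) ≤ 2 * s ^ (2 : ℝ) + 2 * t ^ (2 : ℝ) := by
  have := ENNReal.rpow_add_le_mul_rpow_add_rpow s t (p := 2) (by norm_num)
  norm_num at this ⊢
  rwa [mul_add] at this

/-- If `s ≤ t`, write `s² = s^{1+m} s^{1-m}` and enlarge the second factor. Otherwise expand `(d +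
t)²` and enlarge the first factor of `t² = t^{1+m} t^{1-m}`. With `s = |φ(x)|`, `t = |φ(x + h)|`,
the product is then controlled by the `L^{1+m}` norm alone. -/
theorem rpow_two_le_add_mul {m : ℝ} (hm0 : 0 ≤ m) (hm1 : m ≤ 1) {s t d : ℝ≥0∞} (h : s ≤ d + t) :
    s ^ (2 : ℝ) ≤ 2 * d ^ (2 : ℝ) + 2 * (s ^ (1 + m) * t ^ (1 - m)) := by
  have hsplit : ∀ a : ℝ≥0∞, a ^ (2 : ℝ) = a ^ (1 + m) * a ^ (1 - m) := by
    intro a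
    rw [← ENNReal.rpow_add_of_nonneg _ _ (by linarith) (by linarith)]
    congr 1; ring
  rcases le_total s t with hst | hst
  · refine le_trans ?_ le_add_self
    rw [hsplit, two_mul]
    refine le_trans ?_ le_add_self
    gcongr
  · refine (ENNReal.rpow_le_rpow h (by norm_num)).trans ((add_rpow_two_le d t).trans ?_)
    rw [hsplit t]
    gcongr

/-- Interpolation of the `L²` norm of a test function between `L^{1+m}` and the gradient. -/
theorem lintegral_test_le {m : ℝ} (hm : 0 < m) (hm1 : m < 1) (φ : 𝓓(Ω, ℂ)) (r : ℝ) :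
    (volume (Metric.ball (0 : Eucl N) r)) * ∫⁻ x, ‖φ x‖ₑ ^ (2 : ℝ)
      ≤ volume (Metric.ball (0 : Eucl N) r)
          * (2 * (ENNReal.ofReal r ^ (2 : ℝ) * ∫⁻ x, ‖classicalGrad φ x‖ₑ ^ (2 : ℝ)))
        + 2 * ((∫⁻ x, ‖φ x‖ₑ ^ (1 + m)) * ((∫⁻ x, ‖φ x‖ₑ ^ (1 + m)) ^ ((1 - m) / (1 + m))
          * volume (Metric.ball (0 : Eucl N) r) ^ (1 - (1 - m) / (1 + m)))) := by
  set B : Set (Eucl N) := Metric.ball (0 : Eucl N) r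
  set α : ℝ := (1 - m) / (1 + m) with hα
  have hα0 : 0 ≤ α := div_nonneg (by linarith) (by linarith)
  have hα1 : 0 ≤ 1 - α := by
    rw [hα, sub_nonneg, div_le_one (by linarith)]; linarith
  set Y : ℝ≥0∞ := ∫⁻ x, ‖φ x‖ₑ ^ (1 + m)
  set X : ℝ≥0∞ := ∫⁻ x, ‖classicalGrad φ x‖ₑ ^ (2 : ℝ)
  have hcφ := φ.continuous
  -- Hölder on the ball: `α` is the exponent with `(1 + m) α = 1 - m`, and translation invariance
  -- makes the bound independent of `x`.
  have hholder : ∀ x, ∫⁻ h in B, ‖φ (x + h)‖ₑ ^ (1 - m) ≤ Y ^ α * volume B ^ (1 - α) := by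
    intro x
    have hmeas : AEMeasurable (fun h => ‖φ (x + h)‖ₑ ^ (1 + m)) (volume.restrict B) :=
      ((hcφ.comp (by fun_prop)).enorm.measurable.pow_const _).aemeasurable
    have h := ENNReal.lintegral_mul_norm_pow_le hmeas
      (aemeasurable_const (b := (1 : ℝ≥0∞))) hα0 hα1 (by ring)
    have e : (1 + m) * α = 1 - m := by rw [hα]; field_simp
    simp only [← ENNReal.rpow_mul, e, ENNReal.one_rpow, mul_one, lintegral_one,
      Measure.restrict_apply_univ] at h
    refine h.trans ?_
    gcongr
    calc ∫⁻ h in B, ‖φ (x + h)‖ₑ ^ (1 + m) ≤ ∫⁻ h, ‖φ (x + h)‖ₑ ^ (1 + m) :=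
          setLIntegral_le_lintegral _ _
      _ = Y := lintegral_add_left_eq_self (fun h => ‖φ h‖ₑ ^ (1 + m)) x
  have hd : Measurable (Function.uncurry fun x h : Eucl N => ‖φ (x + h) - φ x‖ₑ ^ (2 : ℝ)) := by
    refine Measurable.pow_const (Continuous.measurable ?_) _
    exact ((hcφ.comp (by fun_prop)).sub (hcφ.comp (by fun_prop))).enorm
  have hpt : ∀ x, volume B * ‖φ x‖ₑ ^ (2 : ℝ)
      ≤ 2 * (∫⁻ h in B, ‖φ (x + h) - φ x‖ₑ ^ (2 : ℝ))
        + 2 * (‖φ x‖ₑ ^ (1 + m) * (Y ^ α * volume B ^ (1 - α))) := by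
    intro x
    have hdx : Measurable fun h => ‖φ (x + h) - φ x‖ₑ ^ (2 : ℝ) :=
      ((hcφ.comp (by fun_prop)).sub continuous_const).enorm.measurable.pow_const _
    have hφx : Measurable fun h => ‖φ (x + h)‖ₑ ^ (1 - m) :=
      (hcφ.comp (by fun_prop)).enorm.measurable.pow_const _
    calc volume B * ‖φ x‖ₑ ^ (2 : ℝ) = ∫⁻ _ in B, ‖φ x‖ₑ ^ (2 : ℝ) := by
          rw [setLIntegral_const, mul_comm]
      _ ≤ ∫⁻ h in B, (2 * ‖φ (x + h) - φ x‖ₑ ^ (2 : ℝ)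
            + 2 * (‖φ x‖ₑ ^ (1 + m) * ‖φ (x + h)‖ₑ ^ (1 - m))) := by
          refine lintegral_mono fun h => rpow_two_le_add_mul hm.le hm1.le ?_
          have e : φ x = (φ x - φ (x + h)) + φ (x + h) := by ring
          calc ‖φ x‖ₑ = ‖(φ x - φ (x + h)) + φ (x + h)‖ₑ := by rw [← e]
            _ ≤ ‖φ x - φ (x + h)‖ₑ + ‖φ (x + h)‖ₑ := enorm_add_le _ _
            _ = _ := by rw [← enorm_neg (φ x - _), neg_sub]
      _ = 2 * (∫⁻ h in B, ‖φ (x + h) - φ x‖ₑ ^ (2 : ℝ))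
            + 2 * (‖φ x‖ₑ ^ (1 + m) * ∫⁻ h in B, ‖φ (x + h)‖ₑ ^ (1 - m)) := by
          rw [lintegral_add_left (hdx.const_mul _), lintegral_const_mul _ hdx,
            lintegral_const_mul _ (hφx.const_mul _), lintegral_const_mul _ hφx]
      _ ≤ _ := by gcongr; exact hholder x
  have hm2 : Measurable fun x => ‖φ x‖ₑ ^ (2 : ℝ) := hcφ.enorm.measurable.pow_const _
  have hmp : Measurable fun x => ‖φ x‖ₑ ^ (1 + m) := hcφ.enorm.measurable.pow_const _
  have hdB : Measurable fun x => ∫⁻ h in B, ‖φ (x + h) - φ x‖ₑ ^ (2 : ℝ) :=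
    hd.lintegral_prod_right'
  calc volume B * ∫⁻ x, ‖φ x‖ₑ ^ (2 : ℝ) = ∫⁻ x, volume B * ‖φ x‖ₑ ^ (2 : ℝ) :=
        (lintegral_const_mul _ hm2).symm
    _ ≤ ∫⁻ x, (2 * (∫⁻ h in B, ‖φ (x + h) - φ x‖ₑ ^ (2 : ℝ))
        + 2 * (‖φ x‖ₑ ^ (1 + m) * (Y ^ α * volume B ^ (1 - α)))) := lintegral_mono hpt
    _ = 2 * (∫⁻ x, ∫⁻ h in B, ‖φ (x + h) - φ x‖ₑ ^ (2 : ℝ))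
        + 2 * (Y * (Y ^ α * volume B ^ (1 - α))) := by
        rw [lintegral_add_left (hdB.const_mul _), lintegral_const_mul _ hdB,
          lintegral_const_mul _ (hmp.mul_const _), lintegral_mul_const _ hmp]
    _ ≤ _ := by
        refine add_le_add ?_ le_rfl
        rw [lintegral_lintegral_swap hd.aemeasurable]
        calc 2 * ∫⁻ h in B, ∫⁻ x, ‖φ (x + h) - φ x‖ₑ ^ (2 : ℝ)
            ≤ 2 * ∫⁻ _ in B, ENNReal.ofReal r ^ (2 : ℝ) * X := by
              gcongr 2 * ?_
              refine setLIntegral_mono' measurableSet_ball fun h hh => ?_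
              refine (lintegral_enorm_sub_translate_le φ h).trans ?_
              gcongr
              rw [← ofReal_norm]
              exact ENNReal.ofReal_le_ofReal (mem_ball_zero_iff.1 hh).le
          _ = _ := by rw [setLIntegral_const]; ring

theorem tendsto_eLpNorm_of_sub {V : Type*} [NormedAddCommGroup V] {μ : Measure (Eucl N)}
    {p : ℝ≥0∞} (hp : 1 ≤ p) {f : Eucl N → V} {g : ℕ → Eucl N → V} (hf : MemLp f p μ)
    (hg : ∀ n, MemLp (g n) p μ)
    (h : Tendsto (fun n => eLpNorm (fun x => f x - g n x) p μ) atTop (𝓝 0)) :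
    Tendsto (fun n => eLpNorm (g n) p μ) atTop (𝓝 (eLpNorm f p μ)) := by
  have hlow : Tendsto (fun n => eLpNorm f p μ - eLpNorm (fun x => f x - g n x) p μ) atTop
      (𝓝 (eLpNorm f p μ)) := by
    simpa using ENNReal.Tendsto.sub (tendsto_const_nhds (x := eLpNorm f p μ)) h
      (Or.inl hf.eLpNorm_ne_top)
  have hup : Tendsto (fun n => eLpNorm f p μ + eLpNorm (fun x => f x - g n x) p μ) atTop
      (𝓝 (eLpNorm f p μ)) := by
    simpa using h.const_add (eLpNorm f p μ)
  refine tendsto_of_tendsto_of_tendsto_of_le_of_le hlow hup (fun n => ?_) (fun n => ?_)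
  · rw [tsub_le_iff_right]
    have e : f = g n + fun x => f x - g n x := by ext x; simp
    calc eLpNorm f p μ = eLpNorm (g n + fun x => f x - g n x) p μ := by rw [← e]
      _ ≤ _ := eLpNorm_add_le (hg n).1 (hf.sub (hg n)).1 hp
  · have e : g n = f - fun x => f x - g n x := by ext x; simp
    calc eLpNorm (g n) p μ = eLpNorm (f - fun x => f x - g n x) p μ := by rw [← e]
      _ ≤ _ := eLpNorm_sub_le hf.1 (hf.sub (hg n)).1 hp

/-- Translation arguments need integrals over all of `ℝ^N`; functions supported in `Ω` allow the
return to norms over `Ω`. -/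
theorem lintegral_enorm_rpow_eq_eLpNorm {V : Type*} [NormedAddCommGroup V] {f : Eucl N → V}
    (hf : Function.support f ⊆ Ω) {p : ℝ} (hp : 0 < p) :
    ∫⁻ x, ‖f x‖ₑ ^ p = eLpNorm f (ENNReal.ofReal p) (leb Ω) ^ p := by
  rw [eLpNorm_eq_lintegral_rpow_enorm_toReal (by simpa using hp) ENNReal.ofReal_ne_top,
    ENNReal.toReal_ofReal hp.le, ← ENNReal.rpow_mul, one_div_mul_cancel hp.ne', ENNReal.rpow_one,
    setLIntegral_eq_of_support_subset]
  intro x hx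
  refine hf fun h0 => hx ?_
  simp [h0, hp]

theorem support_test_subset (φ : 𝓓(Ω, ℂ)) : Function.support φ ⊆ Ω :=
  (subset_tsupport _).trans φ.tsupport_subset

theorem support_classicalGrad_subset (φ : 𝓓(Ω, ℂ)) :
    Function.support (classicalGrad φ) ⊆ Ω := by
  intro x hx
  by_contra h
  refine hx ?_
  ext j
  have : x ∉ Function.support (testPartial j φ) := fun h' => h (support_test_subset _ h')
  simpa [classicalGrad, testPartial_apply] using this

/-- Gagliardo–Nirenberg interpolation at a free scale `r`. -/
theorem lpNormOn_two_sq_le {m : ℝ} (hm : 0 < m) (hm1 : m < 1) {u : Eucl N → ℂ}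
    {Du : Eucl N → CVec N} (hu : MemLp u 2 (leb Ω)) (hDu : MemLp Du 2 (leb Ω))
    (hup : MemLp u (ENNReal.ofReal (m + 1)) (leb Ω)) {ψ : ℕ → 𝓓(Ω, ℂ)}
    (h1 : Tendsto (fun n => eLpNorm (fun x => u x - ψ n x) 2 (leb Ω)) atTop (𝓝 0))
    (h2 : Tendsto (fun n => eLpNorm (fun x => Du x - classicalGrad (ψ n) x) 2 (leb Ω)) atTop
      (𝓝 0))
    (h3 : Tendsto (fun n => eLpNorm (fun x => u x - ψ n x) (ENNReal.ofReal (m + 1)) (leb Ω)) atTop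
      (𝓝 0)) {r : ℝ} (hr : 0 < r) :
    lpNormOn Ω 2 u ^ 2 ≤ 2 * r ^ 2 * lpNormOn Ω 2 Du ^ 2
      + 2 * (volume.real (Metric.ball (0 : Eucl N) r)) ^ (-((1 - m) / (1 + m)))
        * (lpNormOn Ω (m + 1) u ^ (m + 1)) ^ (1 + (1 - m) / (1 + m)) := by
  set V : ℝ≥0∞ := volume (Metric.ball (0 : Eucl N) r) with hV
  set α : ℝ := (1 - m) / (1 + m) with hα
  have hα0 : 0 ≤ α := div_nonneg (by linarith) (by linarith)
  have hVt : V ≠ ⊤ := measure_ball_lt_top.ne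
  have hV0 : V ≠ 0 := (Metric.measure_ball_pos _ _ hr).ne'
  set p : ℝ≥0∞ := ENNReal.ofReal (m + 1) with hp
  have hp1 : 1 ≤ p := by rw [hp, ENNReal.one_le_ofReal]; linarith
  have t1 := tendsto_eLpNorm_of_sub (by simp) hu (fun n => memLp_test (ψ n) 2 _) h1
  have t2 := tendsto_eLpNorm_of_sub (by simp) hDu (fun n => memLp_classicalGrad (ψ n) 2 _) h2
  have t3 := tendsto_eLpNorm_of_sub hp1 hup (fun n => memLp_test (ψ n) p _) h3
  have hVa : V ^ (1 - α) ≠ ⊤ := by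
    refine ENNReal.rpow_ne_top_of_ne_zero hV0 hVt
  have hineq : ∀ n, V * eLpNorm (ψ n) 2 (leb Ω) ^ (2 : ℝ)
      ≤ V * (2 * (ENNReal.ofReal r ^ (2 : ℝ) * eLpNorm (classicalGrad (ψ n)) 2 (leb Ω) ^ (2 : ℝ)))
        + 2 * ((eLpNorm (ψ n) p (leb Ω) ^ (m + 1)) ^ (1 + α) * V ^ (1 - α)) := by
    intro n
    have h := lintegral_test_le hm hm1 (ψ n) r
    rw [add_comm 1 m,
      lintegral_enorm_rpow_eq_eLpNorm (support_test_subset (ψ n)) (by linarith : 0 < m + 1),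
      lintegral_enorm_rpow_eq_eLpNorm (support_test_subset (ψ n)) two_pos,
      lintegral_enorm_rpow_eq_eLpNorm (support_classicalGrad_subset (ψ n)) two_pos,
      ENNReal.ofReal_ofNat, add_comm m 1, ← hα, ← mul_assoc (_ ^ (1 + m))] at h
    rw [ENNReal.rpow_add_of_nonneg _ _ zero_le_one hα0, ENNReal.rpow_one, add_comm m 1]
    rw [hp, add_comm m 1]
    exact h
  have hlim : V * eLpNorm u 2 (leb Ω) ^ (2 : ℝ)
      ≤ V * (2 * (ENNReal.ofReal r ^ (2 : ℝ) * eLpNorm Du 2 (leb Ω) ^ (2 : ℝ)))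
        + 2 * ((eLpNorm u p (leb Ω) ^ (m + 1)) ^ (1 + α) * V ^ (1 - α)) := by
    have l1 := ENNReal.Tendsto.const_mul (a := V) (t1.ennrpow_const 2) (Or.inr hVt)
    have hfr : ENNReal.ofReal r ^ (2 : ℝ) ≠ ⊤ :=
      ENNReal.rpow_ne_top_of_nonneg (by norm_num) ENNReal.ofReal_ne_top
    have l2 := ENNReal.Tendsto.const_mul (a := V) (ENNReal.Tendsto.const_mul (a := 2)
      (ENNReal.Tendsto.const_mul (t2.ennrpow_const 2) (Or.inr hfr)) (Or.inr (by simp)))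
      (Or.inr hVt)
    have l3 := ENNReal.Tendsto.const_mul (a := 2) (ENNReal.Tendsto.mul_const
      ((t3.ennrpow_const (m + 1)).ennrpow_const (1 + α)) (Or.inr hVa)) (Or.inr (by simp))
    exact le_of_tendsto_of_tendsto' l1 (l2.add l3) hineq
  have hfin1 : eLpNorm Du 2 (leb Ω) ^ (2 : ℝ) ≠ ⊤ :=
    ENNReal.rpow_ne_top_of_nonneg (by norm_num) hDu.eLpNorm_ne_top
  have hfin2 : (eLpNorm u p (leb Ω) ^ (m + 1)) ^ (1 + α) ≠ ⊤ :=
    ENNReal.rpow_ne_top_of_nonneg (by linarith)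
      (ENNReal.rpow_ne_top_of_nonneg (by linarith) hup.eLpNorm_ne_top)
  have hfr : ENNReal.ofReal r ^ (2 : ℝ) ≠ ⊤ :=
    ENNReal.rpow_ne_top_of_nonneg (by norm_num) ENNReal.ofReal_ne_top
  have ha : V * (2 * (ENNReal.ofReal r ^ (2 : ℝ) * eLpNorm Du 2 (leb Ω) ^ (2 : ℝ))) ≠ ⊤ :=
    ENNReal.mul_ne_top hVt (ENNReal.mul_ne_top (by simp) (ENNReal.mul_ne_top hfr hfin1))
  have hb : 2 * ((eLpNorm u p (leb Ω) ^ (m + 1)) ^ (1 + α) * V ^ (1 - α)) ≠ ⊤ :=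
    ENNReal.mul_ne_top (by simp) (ENNReal.mul_ne_top hfin2 hVa)
  have hreal := ENNReal.toReal_mono (ENNReal.add_ne_top.2 ⟨ha, hb⟩) hlim
  rw [ENNReal.toReal_add ha hb] at hreal
  simp only [ENNReal.toReal_mul, ← ENNReal.toReal_rpow, ENNReal.toReal_ofNat,
    ENNReal.toReal_ofReal hr.le] at hreal
  simp only [Real.rpow_two] at hreal
  have hvpos : 0 < V.toReal := ENNReal.toReal_pos hV0 hVt
  -- A factor `|B_r|` is extracted so that it cancels from all terms, leaving `|B_r|^{-α}`.
  have hvs : V.toReal ^ (1 - α) = V.toReal * V.toReal ^ (-α) := by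
    rw [sub_eq_add_neg, Real.rpow_add hvpos, Real.rpow_one]
  rw [hvs] at hreal
  simp only [lpNormOn, ENNReal.ofReal_ofNat]
  refine le_of_mul_le_mul_left ?_ hvpos
  refine hreal.trans (le_of_eq ?_)
  simp only [Measure.real, ← hV, ← hp]
  ring

/-! ### The energy identity. -/

theorem lpNormOn_nonneg {V : Type*} [NormedAddCommGroup V] (p : ℝ) (f : Eucl N → V) :
    0 ≤ lpNormOn Ω p f := ENNReal.toReal_nonneg

theorem integral_norm_rpow_eq {V : Type*} [NormedAddCommGroup V] {p : ℝ} (hp : 0 < p)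
    {f : Eucl N → V} (hf : MemLp f (ENNReal.ofReal p) (leb Ω)) :
    ∫ x in (Ω : Set (Eucl N)), ‖f x‖ ^ p = lpNormOn Ω p f ^ p := by
  have h0 : 0 ≤ ∫ x in (Ω : Set (Eucl N)), ‖f x‖ ^ p :=
    integral_nonneg fun x => Real.rpow_nonneg (norm_nonneg _) _
  rw [lpNormOn, hf.eLpNorm_eq_integral_rpow_norm (by simpa using hp) ENNReal.ofReal_ne_top,
    ENNReal.toReal_ofReal hp.le, ENNReal.toReal_ofReal (Real.rpow_nonneg h0 _),
    ← Real.rpow_mul h0, inv_mul_cancel₀ hp.ne', Real.rpow_one]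

theorem integral_norm_sq_eq {V : Type*} [NormedAddCommGroup V] {f : Eucl N → V}
    (hf : MemLp f 2 (leb Ω)) : ∫ x in (Ω : Set (Eucl N)), ‖f x‖ ^ 2 = lpNormOn Ω 2 f ^ 2 := by
  have h := integral_norm_rpow_eq (Ω := Ω) (p := 2) two_pos (f := f)
    (by rwa [ENNReal.ofReal_ofNat])
  simpa only [Real.rpow_two] using h

theorem conjPairing_self {f : Eucl N → ℂ} (hf : MemLp f 2 (leb Ω)) :
    conjPairing Ω f f = ((lpNormOn Ω 2 f ^ 2 : ℝ) : ℂ) := by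
  rw [← integral_norm_sq_eq hf, ← integral_complex_ofReal]
  refine integral_congr_ae (.of_forall fun x => ?_)
  simp only [Complex.mul_conj, Complex.normSq_eq_norm_sq]

theorem sum_conjPairing_self {f : Eucl N → CVec N} (hf : MemLp f 2 (leb Ω)) :
    ∑ j, conjPairing Ω (fun x => f x j) (fun x => f x j) = ((lpNormOn Ω 2 f ^ 2 : ℝ) : ℂ) := by
  unfold conjPairing
  rw [← integral_finsetSum _ fun j _ =>
    integrable_mul_conj (memLp_coord hf j) (memLp_coord hf j), ← integral_norm_sq_eq hf,
    ← integral_complex_ofReal]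
  refine integral_congr_ae (.of_forall fun x => ?_)
  simp only [Complex.mul_conj, Complex.normSq_eq_norm_sq, EuclideanSpace.norm_sq_eq,
    Complex.ofReal_sum]

theorem conjPairing_singularPower {m : ℝ} (hm : 0 < m) {u : Eucl N → ℂ}
    (hu : MemLp u (ENNReal.ofReal (m + 1)) (leb Ω)) :
    conjPairing Ω (fun x => singularPower m (u x)) u
      = ((lpNormOn Ω (m + 1) u ^ (m + 1) : ℝ) : ℂ) := by
  rw [← integral_norm_rpow_eq (by linarith) hu, ← integral_complex_ofReal]
  refine integral_congr_ae (.of_forall fun x => ?_)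
  simp only [singularPower_mul_conj hm]

theorem norm_conjPairing_le {m : ℝ} (hm : 0 < m) {F u : Eucl N → ℂ}
    (hF : MemLp F (ENNReal.ofReal ((m + 1) / m)) (leb Ω))
    (hu : MemLp u (ENNReal.ofReal (m + 1)) (leb Ω)) :
    ‖conjPairing Ω F u‖ ≤ lpNormOn Ω ((m + 1) / m) F * lpNormOn Ω (m + 1) u := by
  have := holderConjugate_ofReal hm
  have h : ‖conjPairing Ω F u‖ₑ ≤ eLpNorm F (ENNReal.ofReal ((m + 1) / m)) (leb Ω)
      * eLpNorm u (ENNReal.ofReal (m + 1)) (leb Ω) := by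
    refine (enorm_integral_le_lintegral_enorm _).trans ?_
    rw [← eLpNorm_one_eq_lintegral_enorm]
    exact eLpNorm_mul_conj_le hF hu
  have h2 := ENNReal.toReal_mono
    (ENNReal.mul_ne_top hF.eLpNorm_ne_top hu.eLpNorm_ne_top) h
  rwa [toReal_enorm, ENNReal.toReal_mul] at h2

/-- Testing the equation with the solution itself. -/
theorem IsLocalWeakSolution.energy_identity {m : ℝ} (hm : 0 < m) {a b : ℂ}
    {F u : Eucl N → ℂ} {Du : Eucl N → CVec N} (h : IsLocalWeakSolution Ω m a b F u)
    (hD : HasWeakGradient Ω u Du) (hF : MemLp F (ENNReal.ofReal ((m + 1) / m)) (leb Ω))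
    (hup : MemLp u (ENNReal.ofReal (m + 1)) (leb Ω)) (hu : MemLp u 2 (leb Ω))
    (hDu : MemLp Du 2 (leb Ω)) {ψ : ℕ → 𝓓(Ω, ℂ)}
    (h1 : Tendsto (fun n => eLpNorm (fun x => u x - ψ n x) 2 (leb Ω)) atTop (𝓝 0))
    (h2 : Tendsto (fun n => eLpNorm (fun x => Du x - classicalGrad (ψ n) x) 2 (leb Ω)) atTop
      (𝓝 0))
    (h3 : Tendsto (fun n => eLpNorm (fun x => u x - ψ n x) (ENNReal.ofReal (m + 1)) (leb Ω)) atTop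
      (𝓝 0)) :
    Complex.I * ((lpNormOn Ω 2 Du ^ 2 : ℝ) : ℂ) + a * ((lpNormOn Ω (m + 1) u ^ (m + 1) : ℝ) : ℂ)
      + b * ((lpNormOn Ω 2 u ^ 2 : ℝ) : ℂ) = conjPairing Ω F u := by
  have := holderConjugate_ofReal hm
  have hw := fun n => h.weak_form hm hD hup hu (ψ n)
  have tF := tendsto_conjPairing hF hup (fun n => memLp_test (ψ n) _ _) h3
  have tg := tendsto_conjPairing (memLp_singularPower hm hup) hup
    (fun n => memLp_test (ψ n) _ _) h3
  have tu := tendsto_conjPairing hu hu (fun n => memLp_test (ψ n) 2 _) h1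
  have tD : ∀ j, Tendsto (fun n => conjPairing Ω (fun x => Du x j) (partialDeriv j (ψ n))) atTop
      (𝓝 (conjPairing Ω (fun x => Du x j) (fun x => Du x j))) := by
    intro j
    refine tendsto_conjPairing (memLp_coord hDu j) (memLp_coord hDu j)
      (fun n => memLp_test (testPartial j (ψ n)) 2 _) ?_
    refine tendsto_of_tendsto_of_tendsto_of_le_of_le tendsto_const_nhds h2
      (fun _ => bot_le) fun n => eLpNorm_mono fun x => ?_
    exact PiLp.norm_apply_le (Du x - classicalGrad (ψ n) x) j
  have tl := ((tendsto_const_nhds (x := Complex.I)).mul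
    (tendsto_finsetSum Finset.univ fun j _ => tD j)).add
    (tg.const_mul a) |>.add (tu.const_mul b)
  have e := tendsto_nhds_unique (tl.congr hw) tF
  rw [sum_conjPairing_self hDu, conjPairing_singularPower hm hup, conjPairing_self hu] at e
  exact e

/-! ### Choice of the scale and assembly of the constants. -/

theorem volume_real_ball {r : ℝ} (hr : 0 < r) :
    volume.real (Metric.ball (0 : Eucl N) r)
      = r ^ N * volume.real (Metric.ball (0 : Eucl N) 1) := by
  rw [Measure.real, Measure.addHaar_ball_of_pos _ _ hr, ENNReal.toReal_mul,
    ENNReal.toReal_ofReal (by positivity), finrank_euclideanSpace_fin, Measure.real]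

/-- Optimizing the scale in the interpolation inequality. -/
theorem le_rpow_of_forall_scale {m ω X Y Z : ℝ} (hm : 0 < m) (hm1 : m < 1) (hω : 0 < ω)
    (hX : 0 ≤ X) (hY : 0 ≤ Y)
    (h : ∀ r : ℝ, 0 < r → Z ≤ 2 * r ^ 2 * X
      + 2 * (r ^ N * ω) ^ (-((1 - m) / (1 + m))) * Y ^ (1 + (1 - m) / (1 + m))) :
    Z ≤ (2 + 2 * ω ^ (-((1 - m) / (1 + m)))) * (X + Y) ^ (1 + expGN N m) := by
  set α : ℝ := (1 - m) / (1 + m) with hα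
  have hα0 : 0 < α := div_pos (by linarith) (by linarith)
  have hσ := expGN_pos (N := N) hm hm1
  set σ := expGN N m with hσd
  -- This relation, equivalent to `1 + α - Nασ/2 = 1 + σ`, makes both terms scale like `E^{1+σ}` for
  -- `r = E^{σ/2}`.
  have hrel : α = σ * (1 + N * α / 2) := by
    have hD : (0 : ℝ) < ((N : ℝ) + 2) - m * ((N : ℝ) - 2) := by
      have : (0 : ℝ) ≤ N * (1 - m) := mul_nonneg (Nat.cast_nonneg _) (by linarith)
      nlinarith
    have h1m : (0 : ℝ) < 1 + m := by linarith
    rw [hα, hσd, expGN]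
    field_simp
    ring
  rcases (add_nonneg hX hY).eq_or_lt with h0 | h0
  · have hX0 : X = 0 := by linarith
    have hY0 : Y = 0 := by linarith
    have h1 := h 1 one_pos
    rw [hX0, hY0, Real.zero_rpow (by linarith)] at h1
    rw [hX0, hY0, add_zero, Real.zero_rpow (by linarith)]
    linarith
  · set E := X + Y with hE
    have hr : 0 < E ^ (σ / 2) := by positivity
    have h1 := h _ hr
    have e1 : (E ^ (σ / 2)) ^ 2 * E = E ^ (1 + σ) := by
      rw [← Real.rpow_natCast, ← Real.rpow_mul h0.le, ← Real.rpow_add_one h0.ne']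
      congr 1; push_cast; ring
    have e2 : ((E ^ (σ / 2)) ^ N * ω) ^ (-α) * E ^ (1 + α) = ω ^ (-α) * E ^ (1 + σ) := by
      rw [Real.mul_rpow (by positivity) hω.le, ← Real.rpow_natCast, ← Real.rpow_mul h0.le,
        ← Real.rpow_mul h0.le, mul_right_comm, ← Real.rpow_add h0, mul_comm]
      congr 2
      linear_combination hrel
    have i1 : 2 * (E ^ (σ / 2)) ^ 2 * X ≤ 2 * E ^ (1 + σ) := by
      rw [← e1, ← mul_assoc]
      gcongr
      linarith
    have i2 : 2 * ((E ^ (σ / 2)) ^ N * ω) ^ (-α) * Y ^ (1 + α) ≤ 2 * (ω ^ (-α) * E ^ (1 + σ)) := by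
      rw [← e2, ← mul_assoc]
      gcongr
      linarith
    linarith

/-- Only the factor `E^σ` is estimated through `E ≤ K S`; one factor `E` is kept, so that a strict
bound `E < K S` still gives a strict final bound. -/
theorem add_mul_rpow_le {c σ E K S : ℝ} (hc : 0 ≤ c) (hσ : 0 < σ) (hE : 0 ≤ E) (hK : 0 ≤ K)
    (hS : 0 ≤ S) (h : E ≤ K * S) :
    E + c * E ^ (1 + σ) ≤ E * ((1 + c) * (1 + K ^ σ) * (1 + S ^ σ)) := by
  have e : E ^ (1 + σ) = E * E ^ σ := by
    rw [Real.rpow_add_of_nonneg hE zero_le_one hσ.le, Real.rpow_one]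
  have h1 : E ^ σ ≤ K ^ σ * S ^ σ := by
    rw [← Real.mul_rpow hK hS]
    exact Real.rpow_le_rpow hE h hσ.le
  have hk : 0 ≤ K ^ σ := Real.rpow_nonneg hK _
  have hs : 0 ≤ S ^ σ := Real.rpow_nonneg hS _
  rw [e]
  calc E + c * (E * E ^ σ) = E * (1 + c * E ^ σ) := by ring
    _ ≤ E * (1 + c * (K ^ σ * S ^ σ)) := by gcongr
    _ ≤ _ := by
      gcongr
      have p1 := mul_nonneg hc hk
      have p2 := mul_nonneg hc hs
      have p3 := mul_nonneg hk hs
      nlinarith [p1, p2, p3]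

end StationaryNLS

theorem theorem4p4 (N : ℕ) (hN : 1 ≤ N) :
    ∃ C : ℝ → ℝ, ContinuousOn C (Set.Ioo 0 1) ∧ (∀ m ∈ Set.Ioo (0 : ℝ) 1, 0 < C m) ∧
      ∀ (Ω : Opens (Eucl N)), (Ω : Set (Eucl N)).Nonempty →
      ∀ (m : ℝ), 0 < m → m < 1 →
      ∀ (a b : ℂ), Admissible a b →
      ∀ (δ : ℝ), 0 < δ →
      ∀ (M : ℝ), IsConstM a b δ M →
      ∀ (F : Eucl N → ℂ), MemLp F (ENNReal.ofReal ((m + 1) / m)) (leb Ω) →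
      ∀ (u : Eucl N → ℂ), IsGlobalWeakSolution Ω m a b F u →
      ∀ (Du : Eucl N → CVec N), HasWeakGradient Ω u Du →
        (energy Ω m u Du ≤ constM0 m (constL a b δ) M * sourceSize Ω m F ∧
          h1NormSq Ω u Du + lpNormOn Ω (m + 1) u ^ (m + 1)
            ≤ C m * constM0tilde N m (constL a b δ) M
              * (1 + lpNormOn Ω ((m + 1) / m) F ^ (expGN N m * (m + 1) / m))
              * sourceSize Ω m F) ∧
        (¬ (F =ᵐ[leb Ω] 0) →
          energy Ω m u Du < constM0 m (constL a b δ) M * sourceSize Ω m F ∧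
          h1NormSq Ω u Du + lpNormOn Ω (m + 1) u ^ (m + 1)
            < C m * constM0tilde N m (constL a b δ) M
              * (1 + lpNormOn Ω ((m + 1) / m) F ^ (expGN N m * (m + 1) / m))
              * sourceSize Ω m F) := by
  set ω : ℝ := volume.real (Metric.ball (0 : Eucl N) 1) with hω
  have hω0 : 0 < ω :=
    ENNReal.toReal_pos (Metric.measure_ball_pos _ _ one_pos).ne' measure_ball_lt_top.ne
  -- `C(m) = 1 + c`, where `c` is the interpolation constant and `ω` the volume of the unit ball;
  -- the `1` accounts for the energy itself.
  refine ⟨fun m => 1 + (2 + 2 * ω ^ (-((1 - m) / (1 + m)))), ?_, fun m _ => by positivity, ?_⟩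
  · intro m hm
    have : (1 : ℝ) + m ≠ 0 := by linarith [hm.1]
    have h1 : ContinuousAt (fun m : ℝ => -((1 - m) / (1 + m))) m :=
      ((continuousAt_const.sub continuousAt_id).div
        (continuousAt_const.add continuousAt_id) this).neg
    exact (continuousAt_const.add (continuousAt_const.add (continuousAt_const.mul
      (ContinuousAt.comp (f := fun m : ℝ => -((1 - m) / (1 + m)))
        (Real.continuousAt_const_rpow hω0.ne') h1)))).continuousWithinAt
  intro Ω _ m hm hm1 a b hab δ hδ M hM F hF u hsol Du hD
  obtain ⟨Dv, hDv, hu, hDv2, φ, hφ1, hφ2⟩ := hsol.memH10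
  have hae := hDv.ae_eq hD
  have hDu : MemLp Du 2 (leb Ω) := hDv2.ae_eq hae
  have hφ2' : Tendsto (fun n => eLpNorm (fun x => Du x - classicalGrad (φ n) x) 2 (leb Ω)) atTop
      (𝓝 0) := by
    refine hφ2.congr fun n => eLpNorm_congr_ae ?_
    filter_upwards [hae] with x hx
    rw [hx]
  have hup := hsol.memLp
  obtain ⟨ψ, h1, h2, h3⟩ := exists_test_tendsto (p := ENNReal.ofReal (m + 1))
    (by rw [ENNReal.one_le_ofReal]; linarith)
    (by rw [← ENNReal.ofReal_ofNat]; exact ENNReal.ofReal_le_ofReal (by linarith))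
    hu hDu hup hφ1 hφ2'
  have hid := hsol.isLocal.energy_identity hm hD hF hup hu hDu h1 h2 h3
  set f := lpNormOn Ω ((m + 1) / m) F with hf
  set y := lpNormOn Ω (m + 1) u with hy
  set X := lpNormOn Ω 2 Du ^ 2 with hX
  set Z := lpNormOn Ω 2 u ^ 2 with hZ
  have hf0 : 0 ≤ f := lpNormOn_nonneg _ _
  have hy0 : 0 ≤ y := lpNormOn_nonneg _ _
  have hX0 : 0 ≤ X := sq_nonneg _
  have hZ0 : 0 ≤ Z := sq_nonneg _
  have hY0 : 0 ≤ y ^ (m + 1) := Real.rpow_nonneg hy0 _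
  have hI := norm_conjPairing_le hm hF hup
  have hL := constL_pos hab hδ
  have hM0 : 0 < M := one_pos.trans_le (one_le_of_isConstM hab hδ hM)
  have hco := add_constL_mul_le hab hδ hM (X := X) hY0 hZ0 (R := (conjPairing Ω F u).re)
    (J := (conjPairing Ω F u).im)
    (by rw [← hid]; simp [Complex.add_re, Complex.mul_re])
    (by rw [← hid]; simp [Complex.add_im, Complex.mul_im])
    ((Complex.abs_re_le_norm _).trans hI) ((Complex.abs_im_le_norm _).trans hI)
  have hE := add_rpow_le_of_add_mul_rpow_le hm hL hM0 hX0 hf0 hy0 hco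
  have hlt := lt_constM0 hm hL hM0
  have hK := constM0_pos (m := m) hL hM0
  set K := constM0 m (constL a b δ) M with hKd
  set S := f ^ ((m + 1) / m) with hS
  have hS0 : 0 ≤ S := Real.rpow_nonneg hf0 _
  have hσ := expGN_pos (N := N) hm hm1
  have hSσ : f ^ (expGN N m * (m + 1) / m) = S ^ expGN N m := by
    rw [hS, ← Real.rpow_mul hf0]
    congr 1; ring
  have hGN := le_rpow_of_forall_scale (N := N) hm hm1 hω0 hX0 hY0 (Z := Z) fun r hr => by
    rw [← volume_real_ball hr]
    exact lpNormOn_two_sq_le hm hm1 hu hDu hup h1 h2 h3 hr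
  have hE0 : 0 ≤ X + y ^ (m + 1) := add_nonneg hX0 hY0
  have hEle : X + y ^ (m + 1) ≤ K * S := hE.trans (mul_le_mul_of_nonneg_right hlt.le hS0)
  set c := 2 + 2 * ω ^ (-((1 - m) / (1 + m))) with hc
  have hc0 : 0 ≤ c := by positivity
  have hfin := add_mul_rpow_le hc0 hσ hE0 hK.le hS0 hEle
  have hfac : 0 < (1 + c) * (1 + K ^ expGN N m) * (1 + S ^ expGN N m) := by
    have := Real.rpow_nonneg hK.le (expGN N m)
    have := Real.rpow_nonneg hS0 (expGN N m)
    positivity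
  have hrhs : (1 + c) * constM0tilde N m (constL a b δ) M * (1 + S ^ expGN N m) * S
      = K * S * ((1 + c) * (1 + K ^ expGN N m) * (1 + S ^ expGN N m)) := by
    rw [constM0tilde, ← hKd]; ring
  have hlhs : Z + X + y ^ (m + 1) ≤
      (X + y ^ (m + 1)) * ((1 + c) * (1 + K ^ expGN N m) * (1 + S ^ expGN N m)) := by
    linarith
  simp only [energy, h1NormSq, sourceSize]
  rw [← hf, ← hy, ← hX, ← hZ, ← hS, hSσ, hrhs]
  refine ⟨⟨hEle, hlhs.trans (mul_le_mul_of_nonneg_right hEle hfac.le)⟩, fun hF0 => ?_⟩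
  -- `F` not almost everywhere zero makes its norm positive, and the gap between the two constants
  -- becomes a strict inequality.
  have hfpos : 0 < f := by
    refine ENNReal.toReal_pos (fun h0 => hF0 ?_) hF.eLpNorm_ne_top
    exact (eLpNorm_eq_zero_iff hF.1 (by simp; positivity)).1 h0
  have hSpos : 0 < S := Real.rpow_pos_of_pos hfpos _
  have hElt : X + y ^ (m + 1) < K * S := hE.trans_lt (mul_lt_mul_of_pos_right hlt hSpos)
  exact ⟨hElt, hlhs.trans_lt (mul_lt_mul_of_pos_right hElt hfac)⟩
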